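/- Let $K$ be a semiring with $0\neq 1$, not necessarily commutative, which is either unordered or equipped with a partial order such that $a\le b\Rightarrow a+c\le b+c$ and $0\le a,\,0\le b\Rightarrow 0\le ab$. Let $f\colon K^*\to K^*$ be a function computed by a $K$-Turing machine $M$ that runs in time $t$ and space $s$, where $t,s\colon\mathbb N\to\mathbb N$. Then there are a BSS$_K$ machine $M'$ computing $f$ and a constant $c\in\mathbb N$ such that for each $x\in K^*$ the machine $M'$ runs on input $x$ in time $$c\,\bigl(t(|x|)+|x|^2+|f(x)|^2+1\bigr)$$ and in space $c\,s(|x|)+c$. Definitions. *BSS$_K$ machines.* A state is a sequence $(x_i)_{i\in\mathbb Z}$ over $K$ with finitely many nonzero entries. A machine is a finite directed graph with nodes $1,\dots,N$; node $1$ is the unique input node (with no incoming edge) and node $N$ the unique output node. Every other node is a computation node (one assignment $x_i:=x_j+x_k$, $x_i:=x_j\cdot x_k$ or $x_i:=c$, with fixed $i,j,k\in\mathbb Z$ and $c\in K$), a branch node (testing $x_1=x_2$, or $x_1\le x_2$ if $K$ is ordered), or a shift node (shifting the state by one position left or right). An input $(x_1,\dots,x_n)$ is placed at coordinates $1,\dots,n$,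 with ones at coordinates $-1,\dots,-n$ and zeros elsewhere. On reaching node $N$ the machine outputs $(x_1,\dots,x_l)$, where $l$ is the number of consecutive ones at coordinates $-1,-2,\dots$. *$K$-Turing machines.* A machine has a finite state set $Q$ with an initial state, a finite set $R$ of $K$-valued registers initialised to $0$, a finite tape alphabet $\Gamma$ disjoint from $K$ with a blank $b\in\Gamma$, a set $O\subseteq\{=,\le\}$ of comparisons ($O\subseteq\{=\}$ if $K$ is unordered), a map $P\colon Q\to O\times R$, an input alphabet $\Sigma\subseteq(\Gamma\setminus\{b\})\cup K$ (here $\Sigma=K$), and a partial map $\delta\colon Q\times(\Gamma\cup\{\top,\bot\})\to Q\times(\Gamma\cup K\cup\{\mathrm{id}\}\cup(\{+,\cdot\}\times R))\times\mathcal P(R)\times\{\sigma_l,\mathrm{id},\sigma_r\}$. Each tape cell holds an element of $\Gamma\cup K$. The input is written on cells $1,\dots,n$ of an otherwise blank tape, and the head is at coordinate $1$. In state $q$ with $a$ under the head, the machine evaluates $\delta(q,a)$ if $a\in\Gamma$, and $\delta(q,v)$ if $a\in K$, where $P(q)=(\circ,r)$ and $v$ is the truth value of $a\circ(\text{value of }r)$.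 If the result is $(q',z,S,\sigma)$, it enters $q'$, replaces $a$ by $z$ (leaves $a$ unchanged if $z=\mathrm{id}$; writes $a\star(\text{old value of }r)$ if $z=(\star,r)$), sets the registers in $S$ to $a$, and shifts the tape by $\sigma$. It halts if $\delta$ is undefined, or if $a\in\Gamma$ and either $S\neq\varnothing$ or $z=(\star,r)$. The output is the string at coordinates $1,2,\dots$ (relative to the head, which is at coordinate $1$) up to the first blank. *Time and space.* Time is the number of steps until halting (reaching node $N$, for BSS$_K$ machines); "in time $T$" means in at most $T$ steps. Space is the number of cells used, where cells keep their identity under shifts. For a $K$-Turing machine a cell is used if at some time it is nonblank or under the head (so all input cells are used). For a BSS$_K$ machine a cell is used if it has initial coordinate in $[-n,n]$, where $n$ is the length of the input, or if at some time it holds a nonzero value or is read or written, including by the output mapping. "In space $S$" means that the machine halts and uses at most $S$ cells. "$M$ runs in time $t$ and space $s$" means that these bounds hold with $T=t(|x|)$ and $S=s(|x|)$ on every input $x$. -/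

import Mathlib

noncomputable section

namespace KMachine

universe u

/-- A partial order on the semiring `K` that makes it an ordered semiring. -/
structure SemiringOrder (K : Type u) [Semiring K] where
  le : K → K → Prop
  le_refl : ∀ a, le a a
  le_trans : ∀ a b c, le a b → le b c → le a c
  le_antisymm : ∀ a b, le a b → le b a → a = b
  add_le_add_right : ∀ a b c, le a b → le (a + c) (b + c)
  mul_nonneg : ∀ a b, le 0 a → le 0 b → le 0 (a * b)

/-! ### BSS machines over a semiring

Throughout, `ord : Option (SemiringOrder K)` says whether `K` is treated as an unordered semiring
(`none`) or as a semiring with a given order (`some o`). -/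

/-- `K_*`: the bi-infinite sequences over `K` with only finitely many nonzero coordinates. -/
abbrev StateSpace (K : Type u) [Semiring K] : Type u := ℤ →₀ K

inductive Dir
  | left
  | right

/-- The number by which a shift changes the index: after a shift, coordinate `i` holds what
coordinate `i + d.delta` held before. -/
def Dir.delta : Dir → ℤ
  | .left => 1
  | .right => -1

/-- The shift operations `σ_l` and `σ_r` on `K_*`. -/
def shiftState {K : Type u} [Semiring K] (d : Dir) (x : StateSpace K) : StateSpace K :=
  x.equivMapDomain (Equiv.subRight d.delta)

theorem shiftState_apply {K : Type u} [Semiring K] (d : Dir) (x : StateSpace K) (i : ℤ) :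
    shiftState d x i = x (i + d.delta) := rfl

/-- The instructions of computation nodes: `x_i := x_j + x_k`, `x_i := x_j * x_k`, `x_i := c`. -/
inductive CompInstr (K : Type u)
  | add (i j k : ℤ)
  | mul (i j k : ℤ)
  | const (i : ℤ) (c : K)

/-- The mapping `g_m : K_* → K_*` of a computation node. -/
def CompInstr.apply {K : Type u} [Semiring K] : CompInstr K → StateSpace K → StateSpace K
  | .add i j k, x => x.update i (x j + x k)
  | .mul i j k, x => x.update i (x j * x k)
  | .const i c, x => x.update i c

/-- The coordinates that are read or written by an instruction. -/
def CompInstr.coords {K : Type u} : CompInstr K → Set ℤ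
  | .add i j k => {i, j, k}
  | .mul i j k => {i, j, k}
  | .const i _ => {i}

/-- The types of nodes, together with their next nodes in `V`. In a branch node, `betaMinus` is
the next node if the test succeeds and `betaPlus` the next node if it fails. -/
inductive BSSNode (K : Type u) (V : Type)
  | input (next : V)
  | output
  | compute (g : CompInstr K) (next : V)
  | branch (betaMinus betaPlus : V)
  | shift (d : Dir) (next : V)

/-- The set of next nodes of a node. -/
def BSSNode.succs {K : Type u} {V : Type} : BSSNode K V → Set V
  | .input w => {w}
  | .output => ∅
  | .compute _ w => {w}
  | .branch w₁ w₂ => {w₁, w₂}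
  | .shift _ w => {w}

/-- A BSS machine over `K`. It has `N = m + 2` nodes; the element `i` of `Fin (m + 2)` is the node
with label `i + 1`. So `0` is the input node and `Fin.last (m + 1)` the output node. The input node
is only executed at the start: no edge leads to it. -/
structure BSSMachine (K : Type u) where
  m : ℕ
  node : Fin (m + 2) → BSSNode K (Fin (m + 2))
  input_iff : ∀ i, (∃ w, node i = .input w) ↔ i = 0
  output_iff : ∀ i, node i = .output ↔ i = Fin.last (m + 1)
  no_return : ∀ i, (0 : Fin (m + 2)) ∉ (node i).succs

/-- The input mapping: `x₁, …, xₙ` are put on coordinates `1, …, n`, ones are put on coordinates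
`-1, …, -n`, and all other coordinates are `0`. -/
def bssInput {K : Type u} [Semiring K] (x : List K) : StateSpace K :=
  Finsupp.onFinset (Finset.Icc (-(x.length : ℤ)) x.length)
    (fun i => if 1 ≤ i then x.getD (i.toNat - 1) 0
      else if -(x.length : ℤ) ≤ i ∧ i ≤ -1 then 1 else 0)
    (by
      intro i hi
      simp only [Finset.mem_Icc]
      by_cases h1 : 1 ≤ i
      · rw [if_pos h1] at hi
        have h2 : i.toNat - 1 < x.length := by
          by_contra h
          exact hi (List.getD_eq_default _ _ (by omega))
        omega
      · rw [if_neg h1] at hi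
        by_cases h2 : -(x.length : ℤ) ≤ i ∧ i ≤ -1
        · omega
        · rw [if_neg h2] at hi
          exact absurd rfl hi)

/-- The number of consecutive ones on the coordinates `-1, -2, …`, starting from `-1`. -/
def bssOutputLength {K : Type u} [Semiring K] (x : StateSpace K) : ℕ :=
  sInf {l : ℕ | x (-((l : ℤ) + 1)) ≠ 1}

/-- The output mapping: the coordinates `1, …, l`, where `l` is `bssOutputLength`. -/
def bssOutput {K : Type u} [Semiring K] (x : StateSpace K) : List K :=
  List.ofFn fun i : Fin (bssOutputLength x) => x ((i : ℤ) + 1)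

/-- The test of a branch node: `a = b`, or `a ≤ b` if `K` is ordered. -/
def branchTest {K : Type u} [Semiring K] (ord : Option (SemiringOrder K)) (a b : K) : Prop :=
  match ord with
  | none => a = b
  | some o => o.le a b

namespace BSSMachine

variable {K : Type u} [Semiring K]

/-- A configuration: a node and a state. The field `offset` is bookkeeping for the measurement of
space and does not influence the computation: it records the shifts made so far. To identify a cell
of the state space independently of shifts, coordinate `i` of the current state is given the
name `i + offset`; this is the coordinate that the cell had at the start. -/
structure Config (M : BSSMachine K) where
  node : Fin (M.m + 2)
  state : StateSpace K
  offset : ℤ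

/-- The initial configuration on input `x`: the input node, with the input mapping applied. -/
def init (M : BSSMachine K) (x : List K) : M.Config :=
  ⟨0, bssInput x, 0⟩

open Classical in
/-- One step of the computation; at the output node the machine has halted and nothing changes. -/
def step (M : BSSMachine K) (ord : Option (SemiringOrder K)) (c : M.Config) : M.Config :=
  match M.node c.node with
  | .input w => ⟨w, c.state, c.offset⟩
  | .output => c
  | .compute g w => ⟨w, g.apply c.state, c.offset⟩
  | .branch w₁ w₂ =>
      ⟨if branchTest ord (c.state 1) (c.state 2) then w₁ else w₂, c.state, c.offset⟩
  | .shift d w => ⟨w, shiftState d c.state, c.offset + d.delta⟩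

/-- The configuration after `n` steps on input `x`. -/
def run (M : BSSMachine K) (ord : Option (SemiringOrder K)) (x : List K) (n : ℕ) : M.Config :=
  (M.step ord)^[n] (M.init x)

/-- On input `x`, the machine reaches the output node within `T` steps. -/
def HaltsWithin (M : BSSMachine K) (ord : Option (SemiringOrder K)) (x : List K) (T : ℕ) : Prop :=
  (M.run ord x T).node = Fin.last (M.m + 1)

/-- The input-output function of the machine is the (total) function `f`. -/
def Computes (M : BSSMachine K) (ord : Option (SemiringOrder K)) (f : List K → List K) : Prop :=
  ∀ x, ∃ n, M.HaltsWithin ord x n ∧ bssOutput (M.run ord x n).state = f x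

/-- The coordinates that are read or written when the node of a configuration is executed. (The
cells written by the input mapping are accounted for in `usedCells`.) -/
def accessed (M : BSSMachine K) (c : M.Config) : Set ℤ :=
  match M.node c.node with
  | .input _ => ∅
  | .output => Set.Icc (-((bssOutputLength c.state : ℤ) + 1)) (bssOutputLength c.state)
  | .compute g _ => g.coords
  | .branch _ _ => {1, 2}
  | .shift _ _ => ∅

/-- The cells of the state space used on input `x`: those that carry the input `x` and its length,
and those that at some time hold a nonzero value or are read or written. -/
def usedCells (M : BSSMachine K) (ord : Option (SemiringOrder K)) (x : List K) : Set ℤ :=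
  Set.Icc (-(x.length : ℤ)) x.length ∪
    {a | ∃ (n : ℕ) (i : ℤ), a = i + (M.run ord x n).offset ∧
      ((M.run ord x n).state i ≠ 0 ∨ i ∈ M.accessed (M.run ord x n))}

/-- On input `x`, the machine reaches the output node and uses at most `S` cells. -/
def UsesSpaceAtMost (M : BSSMachine K) (ord : Option (SemiringOrder K)) (x : List K) (S : ℕ) :
    Prop :=
  (∃ n, M.HaltsWithin ord x n) ∧ (M.usedCells ord x).encard ≤ S

end BSSMachine

/-! ### Turing machines over a semiring -/

/-- The comparison symbols `=` and `≤`. -/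
inductive CmpOp
  | eq
  | le

/-- The truth value of a comparison. (`≤` is only used over ordered semirings.) -/
def CmpOp.Holds {K : Type u} [Semiring K] (ord : Option (SemiringOrder K)) :
    CmpOp → K → K → Prop
  | .eq, a, b => a = b
  | .le, a, b => ∃ o ∈ ord, o.le a b

inductive ArithOp
  | add
  | mul

def ArithOp.eval {K : Type u} [Semiring K] : ArithOp → K → K → K
  | .add, a, b => a + b
  | .mul, a, b => a * b

/-- The set `Γ ∪ K ∪ {id} ∪ ({+, ·} × R)` of write instructions. -/
inductive WriteInstr (K R Γ : Type*)
  | symbol (g : Γ)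
  | value (k : K)
  | id
  | arith (op : ArithOp) (r : R)

/-- The set `{σ_l, id, σ_r}` of moves. -/
inductive Move
  | shift (d : Dir)
  | id

def Move.delta : Move → ℤ
  | .shift d => d.delta
  | .id => 0

/-- A `K`-Turing machine with finite state set `Q`, finite register set `R` and finite tape
alphabet `Γ`. Tape cells hold elements of the disjoint union `Γ ⊕ K`. The input alphabet `Σ` is
called `inputSymbols`. In the argument `Γ ⊕ Bool` of the transition function `δ`, the truth values
`⊤` and `⊥` are `true` and `false`; the value `none` means undefined. -/
structure KTM {K : Type*} [Semiring K] (ord : Option (SemiringOrder K))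
    (Q R Γ : Type*) [Finite Q] [Finite R] [Finite Γ] where
  q₀ : Q
  O : Set CmpOp
  le_notMem : ord = none → CmpOp.le ∉ O
  P : Q → O × R
  b : Γ
  inputSymbols : Set (Γ ⊕ K)
  blank_notMem : Sum.inl b ∉ inputSymbols
  δ : Q → Γ ⊕ Bool → Option (Q × WriteInstr K R Γ × Set R × Move)

namespace KTM

variable {K : Type*} [Semiring K] {ord : Option (SemiringOrder K)}
  {Q R Γ : Type*} [Finite Q] [Finite R] [Finite Γ]

/-- A configuration: state, register values and tape. The head is always at coordinate `1`; a move
shifts the tape. As for BSS machines, `offset` only records the shifts: the tape cell at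
coordinate `i` had coordinate `i + offset` at the start. -/
structure Config (M : KTM ord Q R Γ) where
  state : Q
  regs : R → K
  tape : ℤ → Γ ⊕ K
  offset : ℤ

/-- The input mapping: `w₁, …, wₙ` on coordinates `1, …, n`, blanks elsewhere. -/
def inputTape (M : KTM ord Q R Γ) (w : List (Γ ⊕ K)) : ℤ → Γ ⊕ K :=
  fun i => if 1 ≤ i then w.getD (i.toNat - 1) (Sum.inl M.b) else Sum.inl M.b

def init (M : KTM ord Q R Γ) (w : List (Γ ⊕ K)) : M.Config :=
  ⟨M.q₀, fun _ => 0, M.inputTape w, 0⟩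

open Classical in
/-- The second argument for `δ`: the symbol under the head if it is in `Γ`; otherwise the truth
value of its comparison with a register according to `P`. -/
def scan (M : KTM ord Q R Γ) (c : M.Config) : Γ ⊕ Bool :=
  match c.tape 1 with
  | .inl g => .inl g
  | .inr a =>
      .inr (decide (((M.P c.state).1 : CmpOp).Holds ord a (c.regs (M.P c.state).2)))

/-- The new content of the cell under the head; `none` if the instruction is not applicable. -/
def written (M : KTM ord Q R Γ) (c : M.Config) : WriteInstr K R Γ → Option (Γ ⊕ K)
  | .symbol g => some (.inl g)
  | .value k => some (.inr k)
  | .id => some (c.tape 1)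
  | .arith op r =>
      match c.tape 1 with
      | .inl _ => none
      | .inr a => some (.inr (op.eval a (c.regs r)))

open Classical in
/-- The new register values, when the registers in `s` are to be set to the symbol under the head;
`none` if this is not possible. -/
def stored (M : KTM ord Q R Γ) (c : M.Config) (s : Set R) : Option (R → K) :=
  match c.tape 1 with
  | .inl _ => if s = ∅ then some c.regs else none
  | .inr a => some fun r => if r ∈ s then a else c.regs r

open Classical in
/-- One step of the computation; `none` means that the machine halts. -/
def step (M : KTM ord Q R Γ) (c : M.Config) : Option M.Config :=
  match M.δ c.state (M.scan c) with
  | none => none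
  | some (q, z, s, mv) =>
      match M.written c z, M.stored c s with
      | some y, some ρ =>
          some ⟨q, ρ, fun i => Function.update c.tape 1 y (i + mv.delta), c.offset + mv.delta⟩
      | _, _ => none

/-- The configuration after `n` steps on input `w`; a halted machine stays as it is. -/
def run (M : KTM ord Q R Γ) (w : List (Γ ⊕ K)) (n : ℕ) : M.Config :=
  (fun c => (M.step c).getD c)^[n] (M.init w)

/-- On input `w`, the machine halts after at most `T` steps. -/
def HaltsWithin (M : KTM ord Q R Γ) (w : List (Γ ⊕ K)) (T : ℕ) : Prop :=
  M.step (M.run w T) = none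

/-- The output mapping: the symbols on coordinates `1, 2, …` up to the first blank. -/
def output (M : KTM ord Q R Γ) (tape : ℤ → Γ ⊕ K) : List (Γ ⊕ K) :=
  List.ofFn fun i : Fin (sInf {l : ℕ | tape ((l : ℤ) + 1) = Sum.inl M.b}) => tape ((i : ℤ) + 1)

/-- The input alphabet is `K` and the input-output function is the (total) function
`f : K^* → K^*`. -/
def Computes (M : KTM ord Q R Γ) (f : List K → List K) : Prop :=
  M.inputSymbols = Set.range Sum.inr ∧
    ∀ x : List K, ∃ n, M.HaltsWithin (x.map Sum.inr) n ∧
      M.output (M.run (x.map Sum.inr) n).tape = (f x).map Sum.inr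

/-- The machine halts after at most `t(|w|)` steps on each input word `w`. -/
def RunsInTime (M : KTM ord Q R Γ) (t : ℕ → ℕ) : Prop :=
  ∀ w : List (Γ ⊕ K), (∀ a ∈ w, a ∈ M.inputSymbols) → M.HaltsWithin w (t w.length)

/-- The tape cells used on input `w`: those that are at some time nonblank (in particular the cells
of the input) or under the head. -/
def usedCells (M : KTM ord Q R Γ) (w : List (Γ ⊕ K)) : Set ℤ :=
  {a | ∃ (n : ℕ) (i : ℤ), a = i + (M.run w n).offset ∧
    ((M.run w n).tape i ≠ Sum.inl M.b ∨ i = 1)}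

/-- The machine halts and uses at most `s(|w|)` tape cells on each input word `w`. -/
def RunsInSpace (M : KTM ord Q R Γ) (s : ℕ → ℕ) : Prop :=
  ∀ w : List (Γ ⊕ K), (∀ a ∈ w, a ∈ M.inputSymbols) →
    (∃ n, M.HaltsWithin w n) ∧ (M.usedCells w).encard ≤ s w.length

end KTM

end KMachine

end

/-! A node of a BSS machine sees only fixed coordinates of the shifted state, so a tape cell of `M`
becomes a block of `B = 5 + |Γ| + |R|` consecutive coordinates: two scratch cells, a value in `K`, a
mark, one coordinate per symbol, one per register, and a flag saying whether the content lies in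
`K`. The registers travel with the head, in the current block. The blank has the code zero, so the
zeros outside a finite part of the state already represent the blank part of the tape. One step of
`M` is then a loop-free piece of code with boundedly many nodes (`Simulates.eval_state`,
`Simulates.eval_actCode`), and a move shifts the state by `B` positions.

The quadratic terms pay for the change of format. The input consists of adjacent values, with its
length in unary to the left. A round of unpacking removes a one, gains room for one block by pushing
the ones to the left, and moves all present blocks by `B - 1` cells; this is linear in `|x|`, and
there are `|x|` rounds (`reaches_unpack_round`, `reaches_unpack`). After the simulation the output
is packed by the inverse procedure, in time quadratic in `|f(x)|` (`reaches_pack_round`,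
`reaches_pack`). Within the row of ones there is no scratch space; it is crossed with the test
`isOne`, which restores every cell it touches. Over an ordered `K` a branch tests `≤`, and equality
is tested by two inequalities (`eqTest`).

For the space bound, what matters is the set `U` of offsets at which pieces of code start. During
unpacking and packing these lie in intervals of length `O(|x| + 1)` and `O(|f(x)| + 1)`, and both
lengths are at most `s(|x|)` because the cells of input and output are nonblank. During the
simulation there is one offset for each head position, and head positions are used cells of `M`;
hence there are at most `s(|x|)` of them, however long the computation. `exists_compile_bounds`
turns a run of the code into bounds for a BSS machine, and `exists_bss_bounds` adds them up. -/

noncomputable section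

namespace KMachine

universe u v

/-! ### Loop-free code and its compilation into flowcharts -/

/-- Loop-free code over a window of the state, ending in jumps to labels (`none` means halt). -/
inductive Code (K : Type u) (L : Type v)
  | jump (l : Option L)
  | op (g : CompInstr K) (next : Code K L)
  | branch (yes no : Code K L)
  | shift (d : Dir) (next : Code K L)

section Exec

variable {K : Type u} {L : Type v}

/-- The effect of an instruction when coordinates are named absolutely and the window has
offset `o`. -/
def CompInstr.exec [Semiring K] (g : CompInstr K) (A : ℤ → K) (o : ℤ) : ℤ → K :=
  match g with
  | .add i j k => Function.update A (i + o) (A (j + o) + A (k + o))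
  | .mul i j k => Function.update A (i + o) (A (j + o) * A (k + o))
  | .const i a => Function.update A (i + o) a

open Classical in
/-- The label to which a piece of code jumps, and the state and the offset when it does so. -/
def Code.eval [Semiring K] (ord : Option (SemiringOrder K)) :
    Code K L → (ℤ → K) → ℤ → Option L × (ℤ → K) × ℤ
  | .jump l, A, o => (l, A, o)
  | .op g T, A, o => T.eval ord (g.exec A o) o
  | .branch T F, A, o =>
      if branchTest ord (A (1 + o)) (A (2 + o)) then T.eval ord A o else F.eval ord A o
  | .shift d T, A, o => T.eval ord A (o + d.delta)

/-- An upper bound for the number of nodes executed by a piece of code. -/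
def Code.size : Code K L → ℕ
  | .jump _ => 1
  | .op _ T => T.size + 1
  | .branch T F => max T.size F.size + 1
  | .shift _ T => T.size + 1

def CompInstr.radius : CompInstr K → ℕ
  | .add i j k => max i.natAbs (max j.natAbs k.natAbs)
  | .mul i j k => max i.natAbs (max j.natAbs k.natAbs)
  | .const i _ => i.natAbs

/-- All cells accessed by the code are at most this far from the initial position. -/
def Code.radius : Code K L → ℕ
  -- A jump to a label becomes a branch node, which reads coordinates `1` and `2`.
  | .jump _ => 2
  | .op g T => max g.radius T.radius
  | .branch T F => max 2 (max T.radius F.radius)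
  | .shift _ T => T.radius + 1

/-- The pieces of a piece of code. -/
def Code.subs : Code K L → Set (Code K L)
  | .jump l => {.jump l}
  | .op g T => insert (.op g T) T.subs
  | .branch T F => insert (.branch T F) (T.subs ∪ F.subs)
  | .shift d T => insert (.shift d T) T.subs

theorem Code.finite_subs (T : Code K L) : T.subs.Finite := by
  induction T with
  | jump l => exact Set.finite_singleton _
  | op g T ih => exact ih.insert _
  | branch T F ih₁ ih₂ => exact (ih₁.union ih₂).insert _
  | shift d T ih => exact ih.insert _

theorem Code.mem_subs_self (T : Code K L) : T ∈ T.subs := by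
  cases T <;> simp [subs]

/-- The node of a flowchart that executes the first instruction of a piece of code. -/
def Code.toNode {V : Type} (prog : L → Code K L) (num : Code K L → V) :
    Code K L → BSSNode K V
  | .jump none => .output
  -- A branch with equal exits acts as an unconditional jump.
  | .jump (some l) => .branch (num (prog l)) (num (prog l))
  | .op g T => .compute g (num T)
  | .branch T F => .branch (num T) (num F)
  | .shift d T => .shift d (num T)

end Exec

section Compile

variable {K : Type u} {L : Type v} (prog : L → Code K L)

/-- The pieces of code that become inner nodes. -/
def innerCodes : Set (Code K L) := (⋃ l, (prog l).subs) \ {.jump none}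

variable [Finite L]

/-- Nodes stand for pieces of code and not for their occurrences. Equal pieces may share a node
because the node depends on the piece alone. -/
theorem finite_innerCodes : (innerCodes prog).Finite :=
  (Set.finite_iUnion fun l => (prog l).finite_subs).subset Set.sdiff_subset

/-- The number of inner nodes. -/
def innerCount : ℕ := Nat.card (innerCodes prog)

/-- A numbering of the inner nodes. -/
def codeEquiv : innerCodes prog ≃ Fin (innerCount prog) :=
  haveI := (finite_innerCodes prog).to_subtype
  Finite.equivFin _

open Classical in
/-- The number of the node that belongs to a piece of code. -/
def codeNum (T : Code K L) : Fin (innerCount prog + 2) :=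
  if h : T ∈ innerCodes prog then (codeEquiv prog ⟨T, h⟩).castSucc.succ else Fin.last _

theorem codeNum_ne_zero (T : Code K L) : codeNum prog T ≠ 0 := by
  unfold codeNum
  split_ifs
  · exact Fin.succ_ne_zero _
  · exact Fin.last_pos.ne'

theorem codeNum_jump_none : codeNum prog (.jump none) = Fin.last _ := by
  unfold codeNum
  rw [dif_neg]
  simp [innerCodes]

theorem Code.zero_notMem_succs (T : Code K L) :
    0 ∉ (T.toNode prog (codeNum prog)).succs := by
  have h := codeNum_ne_zero prog
  rcases T with (_ | l) | _ | _ | _ <;>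
    simp [Code.toNode, BSSNode.succs, (h _).symm]

/-- The flowchart node with a given number. -/
def compiledNode (start : L) (i : Fin (innerCount prog + 2)) :
    BSSNode K (Fin (innerCount prog + 2)) :=
  Fin.cases (.input (codeNum prog (prog start)))
    (Fin.lastCases .output fun k =>
      ((codeEquiv prog).symm k : Code K L).toNode prog (codeNum prog)) i

/-- The machine that executes the code of the labels. -/
def compile (start : L) : BSSMachine K where
  m := innerCount prog
  node := compiledNode prog start
  input_iff i := by
    refine Fin.cases (by simp [compiledNode]) (fun j => ?_) i
    refine Fin.lastCases (by simp [compiledNode, -Fin.succ_last, Fin.succ_ne_zero]) (fun k => ?_) j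
    simp only [compiledNode, Fin.cases_succ, Fin.lastCases_castSucc, Fin.succ_ne_zero, iff_false]
    rcases ((codeEquiv prog).symm k : Code K L) with (_ | l) | _ | _ | _ <;> simp [Code.toNode]
  output_iff i := by
    refine Fin.cases ?_ (fun j => ?_) i
    · simp [compiledNode]
    refine Fin.lastCases (by simp [compiledNode, -Fin.succ_last]) (fun k => ?_) j
    have h := ((codeEquiv prog).symm k).2
    simp only [compiledNode, Fin.cases_succ, Fin.lastCases_castSucc]
    constructor
    · intro h'
      rcases hT : ((codeEquiv prog).symm k : Code K L) with (_ | l) | _ | _ | _ <;>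
        rw [hT] at h h' <;> simp [Code.toNode, innerCodes] at h h'
    · intro h'
      have := congrArg Fin.val h'
      simp at this
      omega
  no_return i := by
    refine Fin.cases ?_ (fun j => ?_) i
    · simpa [compiledNode, BSSNode.succs] using (codeNum_ne_zero prog _).symm
    refine Fin.lastCases (by simp [compiledNode, BSSNode.succs, -Fin.succ_last]) (fun k => ?_) j
    simpa only [compiledNode, Fin.cases_succ, Fin.lastCases_castSucc] using
      Code.zero_notMem_succs prog _

theorem compile_node_zero (start : L) :
    (compile prog start).node 0 = .input (codeNum prog (prog start)) := rfl

theorem compile_node_codeNum (start : L) {T : Code K L} (hT : T ∈ innerCodes prog) :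
    (compile prog start).node (codeNum prog T) = T.toNode prog (codeNum prog) := by
  have : codeNum prog T = (codeEquiv prog ⟨T, hT⟩).castSucc.succ := by
    unfold codeNum
    rw [dif_pos hT]
  rw [this]
  simp [compile, compiledNode]

theorem compile_node_last (start : L) :
    (compile prog start).node (Fin.last _) = .output :=
  ((compile prog start).output_iff _).2 rfl

end Compile

/-! ### Paths of configurations with their time and space -/

namespace BSSMachine

variable {K : Type u} [Semiring K] (M : BSSMachine K) (ord : Option (SemiringOrder K))

/-- All cells that are nonzero or accessed in a configuration lie in `Z`. -/
def Within (Z : Set ℤ) (c : M.Config) : Prop :=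
  (∀ i, c.state i ≠ 0 → i + c.offset ∈ Z) ∧ ∀ i ∈ M.accessed c, i + c.offset ∈ Z

/-- The machine gets from `c` to `c'` in at most `k` steps, and the configurations before `c'` use
only cells in `Z`. -/
def Path (Z : Set ℤ) (k : ℕ) (c c' : M.Config) : Prop :=
  ∃ n ≤ k, (M.step ord)^[n] c = c' ∧ ∀ j < n, M.Within Z ((M.step ord)^[j] c)

variable {M ord} {Z : Set ℤ}

theorem Path.refl (c : M.Config) (k : ℕ) : M.Path ord Z k c c :=
  ⟨0, k.zero_le, rfl, fun _ h => absurd h (Nat.not_lt_zero _)⟩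

theorem Path.single {c : M.Config} (h : M.Within Z c) : M.Path ord Z 1 c (M.step ord c) :=
  ⟨1, le_rfl, rfl, fun j hj => by obtain rfl : j = 0 := by omega
                                  exact h⟩

theorem Path.trans {k l : ℕ} {c c' c'' : M.Config} (h₁ : M.Path ord Z k c c')
    (h₂ : M.Path ord Z l c' c'') : M.Path ord Z (k + l) c c'' := by
  obtain ⟨n, hn, rfl, h₁⟩ := h₁
  obtain ⟨n', hn', rfl, h₂⟩ := h₂
  refine ⟨n' + n, by omega, Function.iterate_add_apply _ _ _ _, fun j hj => ?_⟩
  rcases lt_or_ge j n with h | h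
  · exact h₁ j h
  · obtain ⟨i, rfl⟩ := Nat.exists_eq_add_of_le' h
    rw [Function.iterate_add_apply]
    exact h₂ i (by omega)

theorem Path.mono {k l : ℕ} {c c' : M.Config} (h : M.Path ord Z k c c') (hkl : k ≤ l) :
    M.Path ord Z l c c' :=
  let ⟨n, hn, h⟩ := h
  ⟨n, hn.trans hkl, h⟩

theorem step_of_output {c : M.Config} (h : c.node = Fin.last _) : M.step ord c = c := by
  have := (M.output_iff c.node).2 h
  simp only [step, this]

theorem iterate_step_of_output {c : M.Config} (h : c.node = Fin.last _) (n : ℕ) :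
    (M.step ord)^[n] c = c :=
  Function.iterate_fixed (step_of_output h) n

/-- Output configurations are fixed by `step`, so an upper bound for the number of steps is as good
as the exact number. -/
theorem Path.run_eq {x : List K} {k : ℕ} {c : M.Config} (h : M.Path ord Z k (M.init x) c)
    (hc : c.node = Fin.last _) {n : ℕ} (hn : k ≤ n) : M.run ord x n = c := by
  obtain ⟨l, hl, rfl, -⟩ := h
  obtain ⟨j, rfl⟩ := Nat.exists_eq_add_of_le' (hl.trans hn)
  rw [run, Function.iterate_add_apply, iterate_step_of_output hc]

/-- A path controls the configurations before its end. From then on the run is constant, so `hZ`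
takes care of all later times. -/
theorem Path.usedCells_subset {x : List K} {k : ℕ} {c : M.Config}
    (h : M.Path ord Z k (M.init x) c) (hc : c.node = Fin.last _) (hZ : M.Within Z c)
    (hx : Set.Icc (-(x.length : ℤ)) x.length ⊆ Z) : M.usedCells ord x ⊆ Z := by
  refine Set.union_subset hx ?_
  rintro _ ⟨n, i, rfl, h'⟩
  have : M.Within Z (M.run ord x n) := by
    obtain ⟨l, hl, rfl, h⟩ := h
    rcases lt_or_ge n l with h' | h'
    · exact h n h'
    · obtain ⟨j, rfl⟩ := Nat.exists_eq_add_of_le' h'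
      rwa [run, Function.iterate_add_apply, iterate_step_of_output hc]
  exact h'.elim (this.1 i) (this.2 i)

end BSSMachine

/-! ### Correctness of the compilation -/

section Correct

variable {K : Type u} [Semiring K] {L : Type v} {prog : L → Code K L} [Finite L] {start : L}
  {ord : Option (SemiringOrder K)} {Z : Set ℤ}

/-- The configuration `c` is about to execute `T`, with the state `A` in absolute coordinates and
with offset `o`. -/
structure IsAt (c : (compile prog start).Config) (T : Code K L) (A : ℤ → K) (o : ℤ) : Prop where
  node : c.node = codeNum prog T
  state : ∀ i, c.state i = A (i + o)
  offset : c.offset = o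

theorem IsAt.within {c : (compile prog start).Config} {T : Code K L} {A : ℤ → K} {o : ℤ}
    (h : IsAt c T A o) (hA : ∀ i, A i ≠ 0 → i ∈ Z)
    (hacc : ∀ i ∈ (compile prog start).accessed c, i + o ∈ Z) :
    (compile prog start).Within Z c := by
  obtain ⟨-, h₂, rfl⟩ := h
  exact ⟨fun i hi => hA _ (by rwa [← h₂]), hacc⟩

theorem CompInstr.exec_state {s : StateSpace K} {A : ℤ → K} {o : ℤ} (g : CompInstr K)
    (h : ∀ i, s i = A (i + o)) (i : ℤ) : g.apply s i = g.exec A o (i + o) := by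
  cases g <;>
    simp only [CompInstr.apply, CompInstr.exec, Finsupp.coe_update, Function.update_apply, h,
      add_left_inj]

omit [Semiring K] in
theorem CompInstr.coords_radius {g : CompInstr K} {i : ℤ} (h : i ∈ g.coords) :
    i.natAbs ≤ g.radius := by
  cases g <;> simp only [CompInstr.coords, Set.mem_insert_iff, Set.mem_singleton_iff] at h <;>
    simp only [CompInstr.radius] <;> rcases h with rfl | rfl | rfl <;> simp

theorem CompInstr.exec_support (g : CompInstr K) {A : ℤ → K} {o : ℤ}
    (hA : ∀ i, A i ≠ 0 → i ∈ Z) (hZ : ∀ i ∈ g.coords, i + o ∈ Z) :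
    ∀ i, g.exec A o i ≠ 0 → i ∈ Z := by
  intro i hi
  cases g <;> simp only [CompInstr.exec, Function.update_apply] at hi <;> split_ifs at hi with h <;>
    first
    | exact hA i hi
    | (rw [h]; exact hZ _ (by simp [CompInstr.coords]))

/-- Induction on the code: a node executes the first instruction and passes to the node of the
remaining piece, which exists by `hT`. Written cells are within the radius, so the support never
leaves `Z`. -/
theorem IsAt.eval {T : Code K L} (hT : T.subs ⊆ ⋃ l, (prog l).subs) {A : ℤ → K} {o : ℤ}
    {c : (compile prog start).Config} (hc : IsAt c T A o) (hA : ∀ i, A i ≠ 0 → i ∈ Z)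
    (hZ : Set.Icc (o - T.radius) (o + T.radius) ⊆ Z) {l : Option L} {A' : ℤ → K} {o' : ℤ}
    (he : T.eval ord A o = (l, A', o')) :
    ∃ c', (compile prog start).Path ord Z T.size c c' ∧
      IsAt c' (l.elim (.jump none) prog) A' o' ∧ ∀ i, A' i ≠ 0 → i ∈ Z := by
  induction T generalizing A o c with
  | jump l' =>
      cases he
      rcases l with _ | l
      · exact ⟨c, .refl _ _, hc, hA⟩
      · have hn : (compile prog start).node c.node = .branch (codeNum prog (prog l))
            (codeNum prog (prog l)) := by
          rw [hc.node, compile_node_codeNum]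
          · rfl
          · exact ⟨hT (Code.mem_subs_self _), by simp⟩
        refine ⟨_, .single (hc.within hA ?_), ?_, hA⟩
        · intro i hi
          simp only [BSSMachine.accessed, hn, Set.mem_insert_iff, Set.mem_singleton_iff] at hi
          refine hZ ?_
          simp only [Code.radius, Set.mem_Icc]
          omega
        · refine ⟨?_, fun i => ?_, ?_⟩
          · simp only [BSSMachine.step, hn]
            exact ite_self _
          · simp [BSSMachine.step, hn, hc.state]
          · simp [BSSMachine.step, hn, hc.offset]
  | op g T ih =>
      have hn : (compile prog start).node c.node = .compute g (codeNum prog T) := by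
        rw [hc.node, compile_node_codeNum]
        · rfl
        · exact ⟨hT (Code.mem_subs_self _), by simp⟩
      have hacc : ∀ i ∈ g.coords, i + o ∈ Z := by
        intro i hi
        have := CompInstr.coords_radius hi
        refine hZ ?_
        simp only [Code.radius, Set.mem_Icc]
        omega
      have hc' : IsAt ((compile prog start).step ord c) T (g.exec A o) o := by
        refine ⟨by simp only [BSSMachine.step, hn]; rfl, fun i => ?_, ?_⟩ <;>
          simp [BSSMachine.step, hn, hc.offset, CompInstr.exec_state g hc.state]
      obtain ⟨c', h₁, h₂, h₃⟩ := ih ((Set.subset_insert _ _).trans hT) hc'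
        (g.exec_support hA hacc) ((Set.Icc_subset_Icc (by simp only [Code.radius]; omega)
          (by simp only [Code.radius]; omega)).trans hZ) he
      refine ⟨c', (((BSSMachine.Path.single (hc.within hA ?_)).trans h₁).mono ?_), h₂, h₃⟩
      · intro i hi
        simp only [BSSMachine.accessed, hn] at hi
        exact hacc i hi
      · simp only [Code.size]; omega
  | branch T F ih₁ ih₂ =>
      have hn : (compile prog start).node c.node = .branch (codeNum prog T) (codeNum prog F) := by
        rw [hc.node, compile_node_codeNum]
        · rfl
        · exact ⟨hT (Code.mem_subs_self _), by simp⟩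
      have hacc : ∀ i ∈ (compile prog start).accessed c, i + o ∈ Z := by
        intro i hi
        simp only [BSSMachine.accessed, hn, Set.mem_insert_iff, Set.mem_singleton_iff] at hi
        refine hZ ?_
        simp only [Code.radius, Set.mem_Icc]
        omega
      have hs := BSSMachine.Path.single (ord := ord) (hc.within hA hacc)
      rw [Code.eval] at he
      split_ifs at he with h
      · have hc' : IsAt ((compile prog start).step ord c) T A o := by
          refine ⟨?_, fun i => ?_, ?_⟩ <;> simp [BSSMachine.step, hn, hc.offset, hc.state, h]
          rfl
        obtain ⟨c', h₁, h₂, h₃⟩ := ih₁ ((Set.subset_union_left.trans (Set.subset_insert _ _)).trans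
          hT) hc' hA ((Set.Icc_subset_Icc (by simp only [Code.radius]; omega)
          (by simp only [Code.radius]; omega)).trans hZ) he
        exact ⟨c', (hs.trans h₁).mono (by simp only [Code.size]; omega), h₂, h₃⟩
      · have hc' : IsAt ((compile prog start).step ord c) F A o := by
          refine ⟨?_, fun i => ?_, ?_⟩ <;> simp [BSSMachine.step, hn, hc.offset, hc.state, h]
          rfl
        obtain ⟨c', h₁, h₂, h₃⟩ := ih₂ ((Set.subset_union_right.trans (Set.subset_insert _ _)).trans
          hT) hc' hA ((Set.Icc_subset_Icc (by simp only [Code.radius]; omega)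
          (by simp only [Code.radius]; omega)).trans hZ) he
        exact ⟨c', (hs.trans h₁).mono (by simp only [Code.size]; omega), h₂, h₃⟩
  | shift d T ih =>
      have hn : (compile prog start).node c.node = .shift d (codeNum prog T) := by
        rw [hc.node, compile_node_codeNum]
        · rfl
        · exact ⟨hT (Code.mem_subs_self _), by simp⟩
      have hd : d.delta = 1 ∨ d.delta = -1 := by cases d <;> simp [Dir.delta]
      have hc' : IsAt ((compile prog start).step ord c) T A (o + d.delta) := by
        refine ⟨by simp only [BSSMachine.step, hn]; rfl, fun i => ?_, ?_⟩ <;>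
          simp [BSSMachine.step, hn, hc.offset, hc.state, shiftState_apply, add_comm,
            add_left_comm]
      obtain ⟨c', h₁, h₂, h₃⟩ := ih ((Set.subset_insert _ _).trans hT) hc' hA
        (fun i hi => hZ (by simp only [Code.radius, Set.mem_Icc] at hi ⊢; push_cast; omega)) he
      refine ⟨c', (((BSSMachine.Path.single (hc.within hA ?_)).trans h₁).mono ?_), h₂, h₃⟩
      · intro i hi
        simp [BSSMachine.accessed, hn] at hi
      · simp only [Code.size]; omega

/-- `n` pieces of code executed one after the other, all of them started at offsets in `U`. -/
inductive Runs (prog : L → Code K L) (ord : Option (SemiringOrder K)) (U : Set ℤ) :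
    ℕ → Option L × (ℤ → K) × ℤ → Option L × (ℤ → K) × ℤ → Prop
  | refl (c) : Runs prog ord U 0 c c
  | head {n : ℕ} {l : L} {A : ℤ → K} {o : ℤ} {c} (ho : o ∈ U)
      (h : Runs prog ord U n ((prog l).eval ord A o) c) : Runs prog ord U (n + 1) (some l, A, o) c

omit [Finite L] in
theorem Runs.trans {U : Set ℤ} {m n : ℕ} {c c' c'' : Option L × (ℤ → K) × ℤ}
    (h₁ : Runs prog ord U m c c') (h₂ : Runs prog ord U n c' c'') :
    Runs prog ord U (m + n) c c'' := by
  induction h₁ with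
  | refl => simpa using h₂
  | head ho _ ih => rw [Nat.add_right_comm]; exact .head ho (ih h₂)

omit [Finite L] in
theorem Runs.mono {U V : Set ℤ} {n : ℕ} {c c' : Option L × (ℤ → K) × ℤ}
    (h : Runs prog ord U n c c') (hUV : U ⊆ V) : Runs prog ord V n c c' := by
  induction h with
  | refl => exact .refl _
  | head ho _ ih => exact .head (hUV ho) ih

/-- There are finitely many labels, so one `D` bounds the nodes executed per piece and one `W` its
reach. Time is then linear in the number of pieces, and space is governed by the starting offsets.
-/
theorem IsAt.runs {D W : ℕ} (hD : ∀ l, (prog l).size ≤ D) (hW : ∀ l, (prog l).radius ≤ W)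
    {U : Set ℤ} (hU : ∀ u ∈ U, Set.Icc (u - W) (u + W) ⊆ Z) {n : ℕ}
    {a b : Option L × (ℤ → K) × ℤ} (h : Runs prog ord U n a b)
    {c : (compile prog start).Config} (hc : IsAt c (a.1.elim (.jump none) prog) a.2.1 a.2.2)
    (hA : ∀ i, a.2.1 i ≠ 0 → i ∈ Z) :
    ∃ c', (compile prog start).Path ord Z (D * n) c c' ∧
      IsAt c' (b.1.elim (.jump none) prog) b.2.1 b.2.2 ∧ ∀ i, b.2.1 i ≠ 0 → i ∈ Z := by
  induction h generalizing c with
  | refl => exact ⟨c, .refl _ _, hc, hA⟩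
  | @head n l A o b ho h ih =>
      obtain ⟨c₁, h₁, h₂, h₃⟩ := IsAt.eval (ord := ord) (Z := Z) (T := prog l)
        (Set.subset_iUnion (fun l => (prog l).subs) l) hc hA
        ((Set.Icc_subset_Icc (by have := hW l; simp only; omega)
          (by have := hW l; simp only; omega)).trans (hU o ho)) rfl
      obtain ⟨c₂, h₄, h₅, h₆⟩ := ih h₂ h₃
      exact ⟨c₂, (h₁.trans h₄).mono (by have := hD l; rw [Nat.mul_succ]; omega), h₅, h₆⟩

theorem bssInput_support (x : List K) (i : ℤ) (h : bssInput x i ≠ 0) :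
    i ∈ Set.Icc (-(x.length : ℤ)) x.length := by
  have := (bssInput x).mem_support_iff.2 h
  simpa using Finsupp.support_onFinset_subset this

/-- A run of the code from the input mapping to the end gives a bound for the time and the space
of the compiled machine. -/
theorem exists_compile_bounds (prog : L → Code K L) (start : L)
    (ord : Option (SemiringOrder K)) :
    ∃ D W : ℕ, ∀ (x : List K) (U : Set ℤ) (n : ℕ) (A : ℤ → K) (o : ℤ) (y : List K),
      Runs prog ord U n (some start, bssInput x, 0) (none, A, o) →
      (∀ i, i < y.length → A (-((i : ℤ) + 1) + o) = 1) → A (-((y.length : ℤ) + 1) + o) ≠ 1 →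
      (∀ (i : ℕ) (h : i < y.length), A ((i : ℤ) + 1 + o) = y[i]) →
      (compile prog start).HaltsWithin ord x (D * (n + 1)) ∧
      bssOutput ((compile prog start).run ord x (D * (n + 1))).state = y ∧
      (compile prog start).usedCells ord x ⊆ Set.Icc (-(x.length : ℤ)) x.length ∪
        (⋃ u ∈ U, Set.Icc (u - W) (u + W)) ∪
        Set.Icc (o - (y.length + 1)) (o + y.length) := by
  obtain ⟨D, hD⟩ := (Set.finite_range fun l => (prog l).size).bddAbove
  obtain ⟨W, hW⟩ := (Set.finite_range fun l => (prog l).radius).bddAbove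
  -- The input node costs one step more, and `D * n + 1 ≤ (D + 1) * (n + 1)`.
  refine ⟨D + 1, W, fun x U n A o y h h₁ h₂ h₃ => ?_⟩
  set Z : Set ℤ := Set.Icc (-(x.length : ℤ)) x.length ∪ (⋃ u ∈ U, Set.Icc (u - (W : ℤ)) (u + W)) ∪
        Set.Icc (o - (y.length + 1)) (o + y.length) with hZ
  have hx : Set.Icc (-(x.length : ℤ)) x.length ⊆ Z :=
    Set.subset_union_left.trans Set.subset_union_left
  set M := compile prog start
  have hin : M.Within Z (M.init x) := by
    refine ⟨fun i hi => hx ?_, fun i hi => ?_⟩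
    · simpa [BSSMachine.init] using bssInput_support x i hi
    · simp [BSSMachine.accessed, BSSMachine.init, M, compile_node_zero] at hi
  have hc : IsAt (M.step ord (M.init x)) (prog start) (bssInput x) 0 := by
    refine ⟨?_, fun i => ?_, ?_⟩ <;>
      simp [BSSMachine.step, BSSMachine.init, M, compile_node_zero]
    rfl
  obtain ⟨c, hp, hc, hA⟩ := IsAt.runs (D := D) (W := W) (Z := Z)
    (fun l => hD ⟨l, rfl⟩) (fun l => hW ⟨l, rfl⟩) (U := U)
    (fun u hu => (Set.subset_biUnion_of_mem (u := fun u : ℤ => Set.Icc (u - (W : ℤ)) (u + W))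
      hu).trans (Set.subset_union_right.trans Set.subset_union_left)) h hc
    (fun i hi => hx (bssInput_support x i hi))
  have hp := (BSSMachine.Path.single (ord := ord) hin).trans hp
  have hlast : c.node = Fin.last _ := by
    rw [hc.node]
    exact codeNum_jump_none prog
  have hrun : M.run ord x ((D + 1) * (n + 1)) = c :=
    hp.run_eq hlast (by ring_nf; omega)
  have hlen : bssOutputLength c.state = y.length := by
    refine le_antisymm (Nat.sInf_le ?_) (le_csInf ⟨y.length, ?_⟩ fun l hl => ?_)
    · simpa [hc.state] using h₂
    · simpa [hc.state] using h₂
    · by_contra hlt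
      exact hl (by rw [hc.state]; exact h₁ l (by omega))
  refine ⟨?_, ?_, ?_⟩
  · rw [BSSMachine.HaltsWithin, hrun]
    exact hlast
  · rw [hrun]
    refine List.ext_getElem (by simp [bssOutput, hlen]) fun i hi hi' => ?_
    simp only [bssOutput, List.getElem_ofFn, hc.state]
    exact h₃ i hi'
  -- The output mapping reads coordinates `-(l + 1), …, l`, with `l` the output length; the last
  -- interval of `Z` is there for this.
  · refine hp.usedCells_subset hlast (hc.within hA fun i hi => Or.inr ?_) hx
    have hn : (compile prog start).node c.node = .output := by
      rw [hlast]
      exact compile_node_last prog start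
    simp only [BSSMachine.accessed, hn, hlen, Set.mem_Icc] at hi
    simp only [Set.mem_Icc]
    omega

end Correct

/-! ### Copying, filling and testing -/

section Macros

variable {K : Type u} {L : Type v}

/-- A sequence of instructions, followed by `T`. -/
def Code.ops (l : List (CompInstr K)) (T : Code K L) : Code K L := l.foldr .op T

/-- `n` shifts in the same direction, followed by `T`. -/
def Code.shifts (d : Dir) (n : ℕ) (T : Code K L) : Code K L := (Code.shift d)^[n] T

variable [Semiring K]

/-- The effect of a sequence of instructions in absolute coordinates. -/
def execs (l : List (CompInstr K)) (A : ℤ → K) (o : ℤ) : ℤ → K :=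
  l.foldl (fun A g => g.exec A o) A

@[simp] theorem execs_nil (A : ℤ → K) (o : ℤ) : execs [] A o = A := rfl

@[simp] theorem execs_cons (g : CompInstr K) (l : List (CompInstr K)) (A : ℤ → K) (o : ℤ) :
    execs (g :: l) A o = execs l (g.exec A o) o := rfl

theorem execs_append (l l' : List (CompInstr K)) (A : ℤ → K) (o : ℤ) :
    execs (l ++ l') A o = execs l' (execs l A o) o := by
  simp [execs]

@[simp] theorem Code.eval_ops (ord : Option (SemiringOrder K)) (l : List (CompInstr K))
    (T : Code K L) (A : ℤ → K) (o : ℤ) :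
    (Code.ops l T).eval ord A o = T.eval ord (execs l A o) o := by
  induction l generalizing A with
  | nil => rfl
  | cons g l ih => exact ih _

@[simp] theorem Code.eval_shifts (ord : Option (SemiringOrder K)) (d : Dir) (n : ℕ)
    (T : Code K L) (A : ℤ → K) (o : ℤ) :
    (Code.shifts d n T).eval ord A o = T.eval ord A (o + n * d.delta) := by
  induction n generalizing T with
  | zero => simp [Code.shifts]
  | succ n ih =>
      rw [Code.shifts, Function.iterate_succ_apply, ← Code.shifts, ih, Code.eval]
      congr 1
      push_cast
      ring

@[simp] theorem Code.eval_shift (ord : Option (SemiringOrder K)) (d : Dir)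
    (T : Code K L) (A : ℤ → K) (o : ℤ) :
    (Code.shift d T).eval ord A o = T.eval ord A (o + d.delta) := rfl

@[simp] theorem Code.eval_jump (ord : Option (SemiringOrder K)) (l : Option L) (A : ℤ → K) (o : ℤ) :
    (Code.jump l : Code K L).eval ord A o = (l, A, o) := rfl

@[simp] theorem CompInstr.exec_const (i : ℤ) (a : K) (A : ℤ → K) (o : ℤ) :
    (CompInstr.const i a).exec A o = Function.update A (i + o) a := rfl

@[simp] theorem CompInstr.exec_add (i j k : ℤ) (A : ℤ → K) (o : ℤ) :
    (CompInstr.add i j k).exec A o = Function.update A (i + o) (A (j + o) + A (k + o)) := rfl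

@[simp] theorem CompInstr.exec_mul (i j k : ℤ) (A : ℤ → K) (o : ℤ) :
    (CompInstr.mul i j k).exec A o = Function.update A (i + o) (A (j + o) * A (k + o)) := rfl

/-- The assignment `x_d := x_s`, for `d ≠ s`. -/
def copy (d s : ℤ) : List (CompInstr K) := [.const d 0, .add d d s]

theorem execs_copy {d s : ℤ} (h : d ≠ s) (A : ℤ → K) (o : ℤ) :
    execs (copy d s) A o = Function.update A (d + o) (A (s + o)) := by
  ext i
  simp only [copy, execs_cons, execs_nil, CompInstr.exec_const, CompInstr.exec_add,
    Function.update_apply]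
  grind

/-- Parallel assignments `x_d := x_s` for the pairs `(d, s)` of a list. -/
def copies (l : List (ℤ × ℤ)) : List (CompInstr K) := l.flatMap fun a => copy a.1 a.2

theorem execs_copies_of_notMem {l : List (ℤ × ℤ)} (A : ℤ → K) {o i : ℤ}
    (h : ∀ a ∈ l, a.1 + o ≠ i) : execs (copies l) A o i = A i := by
  induction l generalizing A with
  | nil => rfl
  | cons a l ih =>
      rw [copies, List.flatMap_cons, execs_append, ← copies,
        ih _ fun b hb => h b (List.mem_cons_of_mem _ hb)]
      have := h a List.mem_cons_self
      simp only [copy, execs_cons, execs_nil, CompInstr.exec_const, CompInstr.exec_add,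
        Function.update_apply]
      grind

/-- No target is a source by `hd`, so assignments made one after the other have the effect of
parallel ones. -/
theorem execs_copies {l : List (ℤ × ℤ)} (hn : (l.map Prod.fst).Nodup)
    (hd : ∀ a ∈ l, ∀ b ∈ l, a.1 ≠ b.2) (A : ℤ → K) (o : ℤ) {a : ℤ × ℤ} (ha : a ∈ l) :
    execs (copies l) A o (a.1 + o) = A (a.2 + o) := by
  induction l generalizing A with
  | nil => simp at ha
  | cons b l ih =>
      rw [copies, List.flatMap_cons, execs_append, ← copies]
      have hb := execs_copy (hd b List.mem_cons_self b List.mem_cons_self) A o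
      rw [List.map_cons, List.nodup_cons] at hn
      rcases List.mem_cons.1 ha with rfl | ha'
      · rw [execs_copies_of_notMem, hb, Function.update_self]
        intro c hc h
        exact hn.1 (List.mem_map.2 ⟨c, hc, by omega⟩)
      · rw [ih hn.2 (fun c hc d hd' => hd c (List.mem_cons_of_mem _ hc) d
          (List.mem_cons_of_mem _ hd')) _ ha', hb, Function.update_of_ne]
        have := hd b List.mem_cons_self a ha
        omega

/-- The assignments `x_d := v` for the pairs `(d, v)` of a list. -/
def consts (l : List (ℤ × K)) : List (CompInstr K) := l.map fun a => .const a.1 a.2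

theorem execs_consts_of_notMem {l : List (ℤ × K)} (A : ℤ → K) {o i : ℤ}
    (h : ∀ a ∈ l, a.1 + o ≠ i) : execs (consts l) A o i = A i := by
  induction l generalizing A with
  | nil => rfl
  | cons a l ih =>
      rw [consts, List.map_cons, execs_cons, ← consts,
        ih _ fun b hb => h b (List.mem_cons_of_mem _ hb)]
      exact Function.update_of_ne (h a List.mem_cons_self).symm _ _

theorem execs_consts {l : List (ℤ × K)} (hn : (l.map Prod.fst).Nodup) (A : ℤ → K) (o : ℤ)
    {a : ℤ × K} (ha : a ∈ l) : execs (consts l) A o (a.1 + o) = a.2 := by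
  induction l generalizing A with
  | nil => simp at ha
  | cons b l ih =>
      rw [consts, List.map_cons, execs_cons, ← consts]
      rw [List.map_cons, List.nodup_cons] at hn
      rcases List.mem_cons.1 ha with rfl | ha'
      · rw [execs_consts_of_notMem, CompInstr.exec_const, Function.update_self]
        intro c hc h
        exact hn.1 (List.mem_map.2 ⟨c, hc, by omega⟩)
      · exact ih hn.2 _ ha'

/-- The assignments `x_i := v` for the `n` coordinates `i` from `lo` on. -/
def fill (lo : ℤ) (n : ℕ) (v : K) : List (CompInstr K) :=
  (List.range n).map fun j : ℕ => .const (lo + (j : ℤ)) v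

theorem execs_fill (lo : ℤ) (n : ℕ) (v : K) (A : ℤ → K) (o i : ℤ) :
    execs (fill lo n v) A o i = if lo + o ≤ i ∧ i < lo + n + o then v else A i := by
  induction n with
  | zero =>
      rw [if_neg (by omega)]
      rfl
  | succ n ih =>
      rw [fill, List.range_succ, List.map_append, execs_append, ← fill]
      simp only [List.map_cons, List.map_nil, execs_cons, execs_nil, CompInstr.exec_const,
        Function.update_apply, ih]
      grind

/-- The test whether `x₁ = x₂`. For an ordered semiring this takes two branch nodes; `swap`
exchanges `x₁` and `x₂`. -/
def eqTest (ord : Option (SemiringOrder K)) (swap : List (CompInstr K)) (T F : Code K L) :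
    Code K L :=
  match ord with
  | none => .branch T F
  | some _ => .branch (.ops swap (.branch T F)) F

-- With an order, `x₁ = x₂` is tested as `x₁ ≤ x₂` and `x₂ ≤ x₁`, by antisymmetry. The swap takes
-- place only if the first test succeeds, so either of two states may be left behind; users of the
-- test must be able to cope with both.
open Classical in
theorem eval_eqTest (ord : Option (SemiringOrder K)) {swap : List (CompInstr K)} (T F : Code K L)
    {A : ℤ → K} {o : ℤ} (h₁ : execs swap A o (1 + o) = A (2 + o))
    (h₂ : execs swap A o (2 + o) = A (1 + o)) :
    ∃ A', (A' = A ∨ A' = execs swap A o) ∧ (eqTest ord swap T F).eval ord A o =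
      if A (1 + o) = A (2 + o) then T.eval ord A' o else F.eval ord A' o := by
  rcases ord with _ | ord
  · exact ⟨A, .inl rfl, by simp only [eqTest, Code.eval, branchTest]; congr⟩
  · simp only [eqTest, Code.eval, branchTest, Code.eval_ops, h₁, h₂]
    by_cases h : ord.le (A (1 + o)) (A (2 + o))
    · refine ⟨_, .inr rfl, ?_⟩
      rw [if_pos h]
      refine if_congr ⟨fun h' => ord.le_antisymm _ _ h h', fun h' => ?_⟩ rfl rfl
      rw [h']
      exact ord.le_refl _
    · refine ⟨_, .inl rfl, ?_⟩
      rw [if_neg h, if_neg]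
      intro h'
      rw [h'] at h
      exact h (ord.le_refl _)

/-- The test whether `x_a`, which is `0` or `1`, is `1`. Here `a` and `b` are `1` and `2` in any
order, and `x_b` is known to be `v`. The state does not change. -/
def isOne (ord : Option (SemiringOrder K)) (a b : ℤ) (v : K) (T F : Code K L) : Code K L :=
  .ops (copy b a ++ [.const a 1]) (eqTest ord (copy a b ++ [.const b 1])
    (.ops [.const a 1, .const b v] T) (.ops [.const a 0, .const b v] F))

/-- The test destroys both cells, but afterwards both values are known: that of `x_a` from the
branch taken, that of `x_b` by hypothesis. Writing constants restores the state, and no free cell is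
needed. -/
theorem eval_isOne (ord : Option (SemiringOrder K)) {a b : ℤ} {v : K} (T F : Code K L)
    {A : ℤ → K} {o : ℤ} (hab : a = 1 ∧ b = 2 ∨ a = 2 ∧ b = 1) (hb : A (b + o) = v) :
    (A (a + o) = 1 → (isOne ord a b v T F).eval ord A o = T.eval ord A o) ∧
    (A (a + o) = 0 → (0 : K) ≠ 1 → (isOne ord a b v T F).eval ord A o = F.eval ord A o) := by
  have hne : a ≠ b := by omega
  set A₁ := execs (copy b a ++ [.const a 1]) A o with hA₁
  have hA₁' : ∀ i, A₁ i = if i = a + o then 1 else if i = b + o then A (a + o) else A i := by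
    intro i
    simp [hA₁, execs_append, execs_copy hne.symm, Function.update_apply]
  set A₂ := execs (copy a b ++ [.const b 1]) A₁ o with hA₂
  have hA₂' : ∀ i, A₂ i = if i = b + o then 1 else if i = a + o then A (a + o) else A i := by
    intro i
    simp only [hA₂, execs_append, execs_copy hne, Function.update_apply, execs_cons, execs_nil,
      CompInstr.exec_const, hA₁']
    grind
  obtain ⟨A', hA', h⟩ := eval_eqTest ord (swap := copy a b ++ [.const b 1])
    (.ops [.const a 1, .const b v] T) (.ops [.const a 0, .const b v] F) (A := A₁) (o := o)
    (by rw [← hA₂, hA₁', hA₂']; grind) (by rw [← hA₂, hA₁', hA₂']; grind)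
  have hoff : ∀ i, i ≠ a + o → i ≠ b + o → A' i = A i := by
    intro i h₁ h₂
    rcases hA' with rfl | rfl
    · rw [hA₁', if_neg h₁, if_neg h₂]
    · rw [← hA₂, hA₂', if_neg h₂, if_neg h₁]
  have hback : ∀ w, A (a + o) = w → execs [.const a w, .const b v] A' o = A := by
    intro w hw
    ext i
    have := hoff i
    simp only [execs_cons, execs_nil, CompInstr.exec_const, Function.update_apply]
    grind
  have htest : A₁ (1 + o) = A₁ (2 + o) ↔ A (a + o) = 1 := by
    rw [hA₁', hA₁']
    grind
  rw [isOne, Code.eval_ops, ← hA₁, h]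
  constructor
  · intro h1
    rw [if_pos (htest.2 h1), Code.eval_ops, hback _ h1]
  · intro h0 h01
    rw [if_neg (fun h => h01 (h0.symm.trans (htest.1 h))), Code.eval_ops, hback _ h0]

/-- The test whether `x_i`, which is `0` or `1`, is `1`; the coordinates `1` and `2` are
overwritten. -/
def flagTest (ord : Option (SemiringOrder K)) (i : ℤ) (T F : Code K L) : Code K L :=
  .ops (copy 1 i ++ [.const 2 0]) (isOne ord 1 2 0 T F)

/-- Coordinates `1` and `2` of a block carry no information. With `i = 0` the test reads the flag of
the preceding block, or the separator if there is none. -/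
theorem eval_flagTest (ord : Option (SemiringOrder K)) {i : ℤ} (T F : Code K L) (A : ℤ → K)
    (o : ℤ) (hi : i ≠ 1) :
    ∃ A', (∀ j, j ≠ 1 + o → j ≠ 2 + o → A' j = A j) ∧
      (A (i + o) = 1 → (flagTest ord i T F).eval ord A o = T.eval ord A' o) ∧
      (A (i + o) = 0 → (0 : K) ≠ 1 → (flagTest ord i T F).eval ord A o = F.eval ord A' o) := by
  have hA' : ∀ j, execs (copy 1 i ++ [.const 2 0]) A o j =
      if j = 2 + o then 0 else if j = 1 + o then A (i + o) else A j := by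
    intro j
    simp [execs_append, execs_copy hi.symm, Function.update_apply]
  have := eval_isOne ord (a := 1) (b := 2) (v := (0 : K)) T F
    (A := execs (copy 1 i ++ [.const 2 0]) A o) (o := o) (.inl ⟨rfl, rfl⟩) (by simp [hA'])
  refine ⟨execs (copy 1 i ++ [.const 2 0]) A o, fun j h₁ h₂ => by simp [hA', h₁, h₂], ?_⟩
  simpa [flagTest, hA'] using this

end Macros

/-! ### The simulating program -/

/-- The labels of the code that simulates a Turing machine with state set `Q`. -/
inductive Label (Q : Type v)
  | fetch (isEmpty : Bool)
  | growLeft (isEmpty : Bool)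
  | growRight (isEmpty : Bool)
  | moveLeft
  | append
  | rewind
  | state (q : Q)
  | unload
  | seek (isEmpty : Bool)
  | emit
  | moveRight (isFirst : Bool)
  | shrinkLeft (isFirst : Bool)
  | shrinkRight (isFirst : Bool)
  | advance

instance {Q : Type v} [Finite Q] : Finite (Label Q) := by
  let e : Label Q → Option Q × Fin 13 × Bool := fun l => match l with
    | .fetch b => (none, 0, b)
    | .growLeft b => (none, 1, b)
    | .growRight b => (none, 2, b)
    | .moveLeft => (none, 3, true)
    | .append => (none, 4, true)
    | .rewind => (none, 5, true)
    | .state q => (some q, 0, true)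
    | .unload => (none, 6, true)
    | .seek b => (none, 7, b)
    | .emit => (none, 8, true)
    | .moveRight b => (none, 9, b)
    | .shrinkLeft b => (none, 10, b)
    | .shrinkRight b => (none, 11, b)
    | .advance => (none, 12, true)
  refine Finite.of_injective e fun l l' h => ?_
  cases l <;> cases l' <;> simp [e] at h <;> simp [h]

namespace KTM

variable {K : Type*} [Semiring K] {ord : Option (SemiringOrder K)}
  {Q R Γ : Type*} [Finite Q] [Finite R] [Finite Γ]

/-! The tape of a Turing machine is represented by blocks of cells. The coordinates `1` and `2`
of a block are scratch space, coordinate `3` is for an element of `K`, coordinate `4` can mark the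
last one of a sequence of blocks, then there are coordinates for the symbols and the registers, and
the last coordinate tells whether the block represents an element of `K`. -/

def blockSize (_ : KTM ord Q R Γ) : ℕ := 5 + Nat.card Γ + Nat.card R

def symCoord (_ : KTM ord Q R Γ) (g : Γ) : ℤ := 5 + (Finite.equivFin Γ g : ℕ)

def regCoord (_ : KTM ord Q R Γ) (r : R) : ℤ := 5 + Nat.card Γ + (Finite.equivFin R r : ℕ)

def symList (_ : KTM ord Q R Γ) : List Γ :=
  (List.finRange (Nat.card Γ)).map (Finite.equivFin Γ).symm

def regList (_ : KTM ord Q R Γ) : List R :=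
  (List.finRange (Nat.card R)).map (Finite.equivFin R).symm

theorem five_le_blockSize (M : KTM ord Q R Γ) : 5 ≤ M.blockSize := by
  unfold blockSize
  omega

theorem mem_symList (M : KTM ord Q R Γ) (g : Γ) : g ∈ M.symList := by
  simp only [symList, List.mem_map, List.mem_finRange, true_and]
  exact (Finite.equivFin Γ).symm.surjective g

theorem mem_regList (M : KTM ord Q R Γ) (r : R) : r ∈ M.regList := by
  simp only [regList, List.mem_map, List.mem_finRange, true_and]
  exact (Finite.equivFin R).symm.surjective r

theorem nodup_symList (M : KTM ord Q R Γ) : M.symList.Nodup :=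
  (List.nodup_finRange _).map (Finite.equivFin Γ).symm.injective

theorem nodup_regList (M : KTM ord Q R Γ) : M.regList.Nodup :=
  (List.nodup_finRange _).map (Finite.equivFin R).symm.injective

theorem symCoord_injective (M : KTM ord Q R Γ) : Function.Injective M.symCoord := by
  intro g g' h
  refine (Finite.equivFin Γ).injective (Fin.ext ?_)
  unfold symCoord at h
  omega

theorem regCoord_injective (M : KTM ord Q R Γ) : Function.Injective M.regCoord := by
  intro r r' h
  refine (Finite.equivFin R).injective (Fin.ext ?_)
  unfold regCoord at h
  omega

theorem symCoord_bounds (M : KTM ord Q R Γ) (g : Γ) :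
    5 ≤ M.symCoord g ∧ M.symCoord g < 5 + Nat.card Γ := by
  have := (Finite.equivFin Γ g).2
  unfold symCoord
  omega

theorem regCoord_bounds (M : KTM ord Q R Γ) (r : R) :
    5 + Nat.card Γ ≤ M.regCoord r ∧ M.regCoord r < M.blockSize := by
  have := (Finite.equivFin R r).2
  unfold regCoord blockSize
  omega

open Classical in
/-- Code that writes a symbol into the block. -/
def symbolInstrs (M : KTM ord Q R Γ) (g : Γ) : List (CompInstr K) :=
  -- All symbol coordinates of a blank are zero, so cells never touched represent blanks.
  consts ((M.blockSize, 0) ::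
    M.symList.map fun g' => (M.symCoord g', if g' = g ∧ g ≠ M.b then 1 else 0))

/-- Code for a write instruction. -/
def writeInstrs (M : KTM ord Q R Γ) : WriteInstr K R Γ → List (CompInstr K)
  | .symbol g => M.symbolInstrs g
  -- An old symbol code may stay in the block: it is not read while the flag is one.
  | .value k => [.const 3 k, .const M.blockSize 1]
  | .id => []
  | .arith .add r => [.add 3 3 (M.regCoord r)]
  | .arith .mul r => [.mul 3 3 (M.regCoord r)]

open Classical in
/-- Code that sets the registers in `s` to `x₁`. -/
def storeInstrs (M : KTM ord Q R Γ) (s : Set R) : List (CompInstr K) :=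
  copies ((M.regList.filter (· ∈ s)).map fun r => (M.regCoord r, 1))

/-- Code that moves the head, and the registers with it. -/
def moveCode (M : KTM ord Q R Γ) (T : Code K (Label Q)) : Move → Code K (Label Q)
  | .id => T
  | .shift d =>
      -- Old register values stay behind in the block that is left. They are harmless because
      -- `Encodes` ignores register coordinates.
      .ops (copies (M.regList.map fun r => (M.regCoord r + M.blockSize * d.delta, M.regCoord r)))
        (.shifts d M.blockSize T)

/-- Whether the write instruction `z` and the storing of the symbol under the head into the
registers of the set `s` are possible. -/
def Applicable (a : Γ ⊕ Bool) (z : WriteInstr K R Γ) (s : Set R) : Prop :=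
  match a with
  | .inl _ => s = ∅ ∧ ∀ op r, z ≠ .arith op r
  | .inr _ => True

open Classical in
/-- Code that executes a step of the Turing machine when `a` has been scanned in state `q`. -/
def actCode (M : KTM ord Q R Γ) (q : Q) (a : Γ ⊕ Bool) : Code K (Label Q) :=
  match M.δ q a with
  | none => .jump (some .unload)
  | some (q', z, s, mv) =>
      if Applicable a z s then
        -- The order matters: the old content is saved in coordinate `1`, then arithmetic uses the
        -- old registers, and only then the saved content is stored in the registers of `s`.
        .ops (copy 1 3 ++ M.writeInstrs z ++ M.storeInstrs s)
          (M.moveCode (.jump (some (.state q'))) mv)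
      else .jump (some .unload)

/-- Code that finds out which symbol is in the block. -/
def symbolTests (M : KTM ord Q R Γ) (q : Q) (l : List Γ) : Code K (Label Q) :=
  l.foldr (fun g T => flagTest ord (M.symCoord g) (M.actCode q (.inl g)) T) (M.actCode q (.inl M.b))

/-- Code that compares the element of `K` in the block with register `r`. -/
def compareCode (M : KTM ord Q R Γ) (op : CmpOp) (r : R) (T F : Code K (Label Q)) :
    Code K (Label Q) :=
  .ops (copy 1 3 ++ copy 2 (M.regCoord r)) <| match op with
    | .eq => eqTest ord (copy 1 (M.regCoord r) ++ copy 2 3) T F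
    -- Without an order `≤` never holds by `CmpOp.Holds`, whereas a branch node would test equality.
    | .le => if ord = none then F else .branch T F

/-- Code for a state of the Turing machine. -/
def stateCode (M : KTM ord Q R Γ) (q : Q) : Code K (Label Q) :=
  flagTest ord M.blockSize
    (M.compareCode (M.P q).1 (M.P q).2 (M.actCode q (.inr true)) (M.actCode q (.inr false)))
    (M.symbolTests q M.symList)

/-- The code that simulates a Turing machine. First, the input is unpacked into blocks: between
two rounds, there are the ones for the remaining input, a zero, the blocks, and the remaining
input. Then the machine is simulated. Finally, the blocks with the output are packed. -/
def prog (M : KTM ord Q R Γ) : Label Q → Code K (Label Q)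
  -- The separator is at coordinate `0`, hence at coordinate `2` after two shifts, and a one next to
  -- it announces another input element. The argument `e` records whether there are no blocks yet.
  -- Once no ones are left, the registers are cleared, as their cells may contain remnants of the
  -- unpacking.
  | .fetch e => .shifts .right 2 <| isOne ord 1 2 0 (.shift .right (.jump (some (.growLeft e)))) <|
      .shifts .left 2 <| .ops (consts (M.regList.map fun r => (M.regCoord r, 0))) <|
      .jump (some (.state M.q₀))
  -- Here `B - 2` ones are added on the left, and then `growRight` clears `B - 1` cells on the
  -- right: the row becomes shorter by one and its right end moves by `B - 1`.
  | .growLeft e => isOne ord 1 2 1 (.shift .right (.jump (some (.growLeft e)))) <|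
      .ops (fill (4 - M.blockSize) (M.blockSize - 2) 1) (.jump (some (.growRight e)))
  | .growRight e => isOne ord 2 1 1 (.shift .left (.jump (some (.growRight e)))) <|
      .ops (fill (3 - M.blockSize) (M.blockSize - 1) 0) <| .shifts .left 2 <|
      .jump (some (if e then .append else .moveLeft))
  -- The block moves left by `B - 1`. Value, mark and flag are all that has to be moved; the new
  -- flag falls on coordinate `1` of the old block.
  | .moveLeft => .ops (copy (4 - M.blockSize) 3) <| flagTest ord 4
      (.ops [.const (5 - M.blockSize) 0, .const 1 1]
        (.shifts .left M.blockSize (.jump (some .append))))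
      (.ops [.const (5 - M.blockSize) 0, .const 1 1]
        (.shifts .left M.blockSize (.jump (some .moveLeft))))
  -- Coordinate `1` is the cell of the next input element; it becomes the flag of the new last
  -- block.
  | .append => .ops (copy (4 - M.blockSize) 1 ++ [.const (5 - M.blockSize) 1, .const 1 1]) <|
      .shifts .right (M.blockSize - 1) <| .jump (some .rewind)
  | .rewind => flagTest ord 0 (.shifts .right M.blockSize (.jump (some .rewind)))
      (.jump (some (.fetch false)))
  | .state q => M.stateCode q
  -- Coordinate `0` becomes the separator, and the zero at `-1` delimits a row of ones that is still
  -- empty.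
  | .unload => .ops [.const 0 0, .const (-1) 0] (.jump (some (.seek true)))
  -- The output ends at the first zero flag. Stale marks are erased on the way, and the last block
  -- is marked; `e` says that no block has been passed, in which case the output is empty.
  | .seek e => flagTest ord M.blockSize
      (.ops [.const 4 0] (.shifts .left M.blockSize (.jump (some (.seek false)))))
      (if e then .jump none else
        .shifts .right M.blockSize (.ops [.const 4 1] (.jump (some .emit))))
  -- The value of the last block goes to the last cell of this block, just before the values already
  -- packed.
  | .emit => .ops (copy M.blockSize 3) (.jump (some (.moveRight true)))
  -- The preceding block is recreated at `-1`, so coordinate `3` is its mark; the first block moved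
  -- in a round becomes the last block. If the separator is met while `e` is still true, no block is
  -- left and this round is the final one.
  | .moveRight e => flagTest ord 0
      (.ops (.const 3 (if e then 1 else 0) ::
        copy 2 (3 - M.blockSize) ++ [.const (M.blockSize - 1) 1])
        (.shifts .right M.blockSize (.jump (some (.moveRight false)))))
      (.ops (fill 0 (M.blockSize - 1) 1 ++ [.const (M.blockSize - 1) 0])
        (.shifts .right 2 (.jump (some (.shrinkLeft e)))))
  -- `moveRight` has added `B - 1` ones on the right and `B - 2` are erased here on the left, which
  -- leaves one more than before.
  | .shrinkLeft e => isOne ord 1 2 1 (.shift .right (.jump (some (.shrinkLeft e)))) <|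
      .ops (fill 2 (M.blockSize - 2) 0) <| .shifts .left (M.blockSize - 1) <|
      .jump (some (.shrinkRight e))
  | .shrinkRight e => isOne ord 2 1 1 (.shift .left (.jump (some (.shrinkRight e)))) <|
      .shifts .left 2 <| .jump (if e then none else some .advance)
  | .advance => flagTest ord 4 (.jump (some .emit))
      (.shifts .left M.blockSize (.jump (some .advance)))

end KTM

/-! ### Sequences of blocks -/

section Blocks

variable {K : Type*} [Semiring K]

/-- The block at `p` represents the element `v` of `K`, and its mark satisfies `m`. -/
structure Blk (B : ℕ) (m : K → Prop) (A : ℤ → K) (p : ℤ) (v : K) : Prop where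
  val : A (p + 3) = v
  mark : m (A (p + 4))
  flag : A (p + B) = 1

/-- Consecutive blocks from `p` to `q` represent the elements of a list. -/
def Blks (B : ℕ) (m : K → Prop) (A : ℤ → K) : ℤ → List K → ℤ → Prop
  | p, [], q => p = q
  | p, v :: vs, q => Blk B m A p v ∧ Blks B m A (p + B) vs q

variable {B : ℕ} {m m' : K → Prop} {A A' : ℤ → K}

theorem Blk.congr {p : ℤ} {v : K} (h : Blk B m A p v) (h₃ : A' (p + 3) = A (p + 3))
    (h₄ : A' (p + 4) = A (p + 4)) (h₅ : A' (p + B) = A (p + B)) : Blk B m A' p v :=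
  ⟨h₃.trans h.val, h₄ ▸ h.mark, h₅.trans h.flag⟩

theorem Blks.le {p q : ℤ} {vs : List K} (h : Blks B m A p vs q) : q = p + vs.length * B := by
  induction vs generalizing p with
  | nil => simpa using Eq.symm h
  | cons v vs ih =>
      rw [ih h.2, List.length_cons]
      push_cast
      ring

theorem Blks.le' {p q : ℤ} {vs : List K} (h : Blks B m A p vs q) : p ≤ q := by
  rw [h.le]
  exact le_add_of_nonneg_right (by positivity)

theorem Blks.congr {p q : ℤ} {vs : List K} (hB : 5 ≤ B) (h : Blks B m A p vs q)
    (hA : ∀ i, p < i → i ≤ q → A' i = A i) : Blks B m A' p vs q := by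
  induction vs generalizing p with
  | nil => exact h
  | cons v vs ih =>
      have := h.2.le'
      exact ⟨h.1.congr (hA _ (by omega) (by omega)) (hA _ (by omega) (by omega))
        (hA _ (by omega) (by omega)), ih h.2 fun i h₁ h₂ => hA i (by omega) h₂⟩

theorem Blks.append {p q r : ℤ} {vs ws : List K} (h : Blks B m A p vs q) (h' : Blks B m A q ws r) :
    Blks B m A p (vs ++ ws) r := by
  induction vs generalizing p with
  | nil => cases h; exact h'
  | cons v vs ih => exact ⟨h.1, ih h.2⟩

theorem Blks.single {p q : ℤ} {v : K} (h : Blk B m A p v) (hq : q = p + B) :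
    Blks B m A p [v] q := ⟨h, hq.symm⟩

theorem Blks.of_append {p r : ℤ} {vs : List K} {v : K} (h : Blks B m A p (vs ++ [v]) r) :
    Blks B m A p vs (r - B) ∧ Blk B m A (r - B) v := by
  induction vs generalizing p with
  | nil =>
      obtain ⟨h₁, h₂⟩ := h
      change p + B = r at h₂
      have : r - B = p := by omega
      rw [this]
      exact ⟨rfl, h₁⟩
  | cons w vs ih => exact ⟨⟨h.1, (ih h.2).1⟩, (ih h.2).2⟩

theorem Blks.getElem {p q : ℤ} {vs : List K} (h : Blks B m A p vs q) (j : ℕ) (hj : j < vs.length) :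
    Blk B m A (p + B * j) vs[j] := by
  induction vs generalizing p j with
  | nil => simp at hj
  | cons v vs ih =>
      rcases j with _ | j
      · simpa using h.1
      · have := ih h.2 j (by simpa using hj)
        rw [List.getElem_cons_succ]
        convert this using 1
        push_cast
        ring

theorem Blks.of_getElem {p q : ℤ} {vs : List K} (hq : q = p + vs.length * B)
    (h : ∀ (j : ℕ) (hj : j < vs.length), Blk B m A (p + B * j) vs[j]) : Blks B m A p vs q := by
  induction vs generalizing p with
  | nil => simpa [Blks] using hq.symm
  | cons v vs ih =>
      refine ⟨?_, ih ?_ fun j hj => ?_⟩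
      · have := h 0 (by simp)
        rw [List.getElem_cons_zero] at this
        simpa using this
      · rw [hq, List.length_cons]
        push_cast
        ring
      · have := h (j + 1) (by simpa using hj)
        rw [List.getElem_cons_succ] at this
        convert this using 1
        push_cast
        ring

end Blocks

/-! ### Runs of the program and walks over ones -/

namespace KTM

variable {K : Type*} [Semiring K] {ord : Option (SemiringOrder K)}
  {Q R Γ : Type*} [Finite Q] [Finite R] [Finite Γ] (M : KTM ord Q R Γ) {U : Set ℤ}

/-- The code gets from `a` to `b` by at most `k` jumps, made from offsets in `U`. -/
def Reaches (U : Set ℤ) (k : ℕ) (a b : Option (Label Q) × (ℤ → K) × ℤ) : Prop :=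
  ∃ n ≤ k, Runs M.prog ord U n a b

variable {M}

theorem Reaches.refl (a : Option (Label Q) × (ℤ → K) × ℤ) : M.Reaches U 0 a a :=
  ⟨0, le_rfl, .refl _⟩

theorem Reaches.trans {k l : ℕ} {a b c : Option (Label Q) × (ℤ → K) × ℤ}
    (h : M.Reaches U k a b) (h' : M.Reaches U l b c) : M.Reaches U (k + l) a c :=
  let ⟨_, hm, h⟩ := h
  let ⟨_, hn, h'⟩ := h'
  ⟨_, Nat.add_le_add hm hn, h.trans h'⟩

theorem Reaches.mono {k l : ℕ} {a b : Option (Label Q) × (ℤ → K) × ℤ}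
    (h : M.Reaches U k a b) (hkl : k ≤ l) : M.Reaches U l a b :=
  let ⟨n, hm, h⟩ := h
  ⟨n, hm.trans hkl, h⟩

theorem Reaches.single {l : Label Q} {A : ℤ → K} {o : ℤ} {b : Option (Label Q) × (ℤ → K) × ℤ}
    (ho : o ∈ U) (h : (M.prog l).eval ord A o = b) : M.Reaches U 1 (some l, A, o) b :=
  ⟨1, le_rfl, .head ho (h ▸ .refl _)⟩

theorem Reaches.head {l : Label Q} {A : ℤ → K} {o : ℤ} {b c : Option (Label Q) × (ℤ → K) × ℤ}
    {k : ℕ} (ho : o ∈ U) (h : (M.prog l).eval ord A o = b) (h' : M.Reaches U k b c) :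
    M.Reaches U (k + 1) (some l, A, o) c :=
  ((Reaches.single ho h).trans h').mono (by omega)

variable [Nontrivial K]

/-- Walking to the left over ones. -/
theorem reaches_walkLeft {l : Label Q} {F : Code K (Label Q)}
    (hl : M.prog l = isOne ord 1 2 1 (.shift .right (.jump (some l))) F) {A : ℤ → K} {lo w : ℤ}
    (hw : lo ≤ w + 1) (hA : ∀ i, lo < i → i ≤ w + 2 → A i = 1) (hlo : A lo = 0)
    (hU : Set.Icc (lo - 1) w ⊆ U) :
    M.Reaches U ((w + 2 - lo).toNat) (some l, A, w) (F.eval ord A (lo - 1)) := by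
  obtain ⟨n, hn⟩ : ∃ n : ℕ, w + 1 - lo = n := ⟨(w + 1 - lo).toNat, by omega⟩
  induction n generalizing w with
  | zero =>
      obtain rfl : w = lo - 1 := by omega
      refine (Reaches.single (hU (by simp)) ?_).mono (by omega)
      rw [hl, (eval_isOne ord _ _ (.inl ⟨rfl, rfl⟩) (hA _ (by omega) (by omega))).2
        (by rw [← hlo]; congr 1; omega) zero_ne_one]
  | succ n ih =>
      refine (Reaches.head (hU (by simp; omega)) ?_ (ih (w := w - 1) (by omega)
        (fun i h₁ h₂ => hA i h₁ (by omega)) ((Set.Icc_subset_Icc le_rfl (by omega)).trans hU)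
        (by omega))).mono (by omega)
      rw [hl, (eval_isOne ord _ _ (.inl ⟨rfl, rfl⟩) (hA _ (by omega) (by omega))).1
        (hA _ (by omega) (by omega))]
      rfl

/-- Walking to the right over ones. -/
theorem reaches_walkRight {l : Label Q} {F : Code K (Label Q)}
    (hl : M.prog l = isOne ord 2 1 1 (.shift .left (.jump (some l))) F) {A : ℤ → K} {p w : ℤ}
    (hw : w + 2 ≤ p) (hA : ∀ i, w < i → i < p → A i = 1) (hp : A p = 0)
    (hU : Set.Icc w (p - 2) ⊆ U) :
    M.Reaches U ((p - w).toNat) (some l, A, w) (F.eval ord A (p - 2)) := by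
  obtain ⟨n, hn⟩ : ∃ n : ℕ, p - 2 - w = n := ⟨(p - 2 - w).toNat, by omega⟩
  induction n generalizing w with
  | zero =>
      obtain rfl : w = p - 2 := by omega
      refine (Reaches.single (hU (by simp)) ?_).mono (by omega)
      rw [hl, (eval_isOne ord _ _ (.inr ⟨rfl, rfl⟩) (hA _ (by omega) (by omega))).2
        (by rw [← hp]; congr 1; omega) zero_ne_one]
  | succ n ih =>
      refine (Reaches.head (hU (by simp; omega)) ?_ (ih (w := w + 1) (by omega)
        (fun i h₁ h₂ => hA i (by omega) h₂) ((Set.Icc_subset_Icc (by omega) le_rfl).trans hU)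
        (by omega))).mono (by omega)
      rw [hl, (eval_isOne ord _ _ (.inr ⟨rfl, rfl⟩) (hA _ (by omega) (by omega))).1
        (hA _ (by omega) (by omega))]
      rfl

/-! ### Unpacking the input -/

/-- Both branches make the same assignments, so one `A'` serves for both outcomes. The mark at `h +
4` is still intact when tested, since the copy goes to a cell before the block. -/
theorem eval_moveLeft (A : ℤ → K) (h : ℤ) :
    ∃ A', A' (h + 4 - M.blockSize) = A (h + 3) ∧ A' (h + 5 - M.blockSize) = 0 ∧ A' (h + 1) = 1 ∧
      (∀ i, i ≤ h + 1 - M.blockSize ∨ h + 2 < i → A' i = A i) ∧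
      (A (h + 4) = 0 → (M.prog .moveLeft).eval ord A h = (some .moveLeft, A', h + M.blockSize)) ∧
      (A (h + 4) = 1 → (M.prog .moveLeft).eval ord A h = (some .append, A', h + M.blockSize)) := by
  have hB := M.five_le_blockSize
  have h₁ := execs_copy (d := 4 - M.blockSize) (s := 3) (by omega) A h
  set A₁ := execs (copy (4 - (M.blockSize : ℤ)) 3) A h
  obtain ⟨A₂, h₂, h₃, h₄⟩ := eval_flagTest ord (i := 4)
      (.ops [.const (5 - M.blockSize) 0, .const 1 1]
        (.shifts .left M.blockSize (.jump (some .append))))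
      (.ops [.const (5 - M.blockSize) 0, .const 1 1]
        (.shifts .left M.blockSize (.jump (some (Label.moveLeft (Q := Q)))))) A₁ h (by omega)
  have h₅ : A₁ (4 + h) = A (h + 4) := by
    rw [h₁, Function.update_of_ne (by omega), add_comm]
  have h₆ : ∀ i, execs [.const (5 - M.blockSize) 0, .const 1 1] A₂ h i =
      if i = 1 + h then 1 else if i = 5 - M.blockSize + h then 0 else A₂ i := by
    simp [Function.update_apply]
  simp only [Code.eval_ops, Code.eval_shifts, Code.eval_jump, h₅, Dir.delta, mul_one] at h₃ h₄
  refine ⟨execs [.const (5 - M.blockSize) 0, .const 1 1] A₂ h, ?_, ?_, ?_, fun i hi => ?_,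
    fun h0 => ?_, fun h1 => ?_⟩
  · rw [h₆, if_neg (by omega), if_neg (by omega), h₂ _ (by omega) (by omega), h₁,
      show h + 4 - (M.blockSize : ℤ) = 4 - M.blockSize + h by ring, Function.update_self, add_comm]
  · rw [h₆, if_neg (by omega), if_pos (by omega)]
  · rw [h₆, if_pos (by omega)]
  · rw [h₆, if_neg (by omega), if_neg (by omega), h₂ _ (by omega) (by omega), h₁,
      Function.update_of_ne (by omega)]
  · rw [← h₄ h0 zero_ne_one, prog, Code.eval_ops]
  · rw [← h₃ h1, prog, Code.eval_ops]

/-- Blocks are moved from left to right. Moving the one at `h` changes only cells from `h + 2 - B`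
to `h + 2`: the blocks moved before end at `h + 1 - B`, and those still to be moved start at `h +
B`. -/
theorem reaches_moveLeft {A : ℤ → K} {p h q : ℤ} {us ws : List K} {w : K}
    (hus : Blks M.blockSize (· = 0) A p us (h + 1 - M.blockSize))
    (hws : Blks M.blockSize (· = 0) A h ws (q - M.blockSize))
    (hw : Blk M.blockSize (· = 1) A (q - M.blockSize) w) (hU : Set.Icc h q ⊆ U) :
    ∃ A', M.Reaches U (ws.length + 1) (some .moveLeft, A, h) (some .append, A', q) ∧
      Blks M.blockSize (· = 0) A' p (us ++ ws ++ [w]) (q + 1 - M.blockSize) ∧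
      ∀ i, i ≤ h + 1 - M.blockSize ∨ q < i → A' i = A i := by
  have hB := M.five_le_blockSize
  obtain ⟨A', h₁, h₂, h₃, h₄, h₅, h₆⟩ := M.eval_moveLeft A h
  have hb : Blk M.blockSize (· = 0) A' (h + 1 - M.blockSize) (A (h + 3)) := by
    refine ⟨?_, ?_, ?_⟩
    · rw [← h₁]; congr 1; ring
    · rw [← h₂]; congr 1; ring
    · rw [← h₃]; congr 1; ring
  have hus' := (hus.congr (A' := A') hB fun i _ hi => h₄ i (.inl hi)).append
    (Blks.single hb rfl)
  induction ws generalizing h us A A' with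
  | nil =>
      obtain rfl : h = q - M.blockSize := hws
      refine ⟨A', Reaches.single (hU (by simp)) ?_, ?_, fun i hi => h₄ i (by omega)⟩
      · rw [h₆ hw.mark, sub_add_cancel]
      · rw [← hw.val, List.append_nil]
        convert hus' using 1
        ring
  | cons v ws ih =>
      have hle := hws.2.le'
      obtain ⟨A'', g₁, g₂, g₃, g₄, g₅, g₆⟩ := M.eval_moveLeft A' (h + M.blockSize)
      have hus'' : Blks M.blockSize (· = 0) A' p (us ++ [v]) (h + M.blockSize + 1 - M.blockSize) := by
        rw [← hws.1.val]
        convert hus' using 1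
        ring
      obtain ⟨A₃, r₁, r₂, r₃⟩ := ih hus''
        (hws.2.congr hB fun i hi _ => h₄ i (by omega))
        (hw.congr (h₄ _ (by omega)) (h₄ _ (by omega)) (h₄ _ (by omega)))
        ((Set.Icc_subset_Icc (by omega) le_rfl).trans hU) A'' g₁ g₂ g₃ g₄ g₅ g₆
        ⟨by rw [← g₁]; congr 1; ring, by rw [← g₂]; congr 1; ring, by rw [← g₃]; congr 1; ring⟩
        ((hus''.congr hB fun i _ hi => g₄ i (.inl hi)).append (Blks.single
          ⟨by rw [← g₁]; congr 1; ring, by rw [← g₂]; congr 1; ring, by rw [← g₃]; congr 1; ring⟩ rfl))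
      refine ⟨A₃, Reaches.head (hU (by simp; omega)) (h₅ hws.1.mark) r₁, by simpa using r₂,
        fun i hi => ?_⟩
      rw [r₃ i (by omega), h₄ i (by omega)]

omit [Nontrivial K] in
theorem reaches_append {A : ℤ → K} {q : ℤ} (hU : q ∈ U) :
    ∃ A', M.Reaches U 1 (some .append, A, q) (some .rewind, A', q + 1 - M.blockSize) ∧
      Blk M.blockSize (· = 1) A' (q + 1 - M.blockSize) (A (q + 1)) ∧
      ∀ i, i ≤ q + 1 - M.blockSize ∨ q + 1 < i → A' i = A i := by
  have hB := M.five_le_blockSize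
  have h₁ := execs_copy (d := 4 - M.blockSize) (s := 1) (by omega) A q
  have h₂ : ∀ i, execs (copy (4 - (M.blockSize : ℤ)) 1 ++
      [.const (5 - (M.blockSize : ℤ)) 1, .const 1 1]) A q i =
      if i = 1 + q then 1 else if i = 5 - M.blockSize + q then 1 else
      if i = 4 - M.blockSize + q then A (q + 1) else A i := by
    simp [execs_append, h₁, Function.update_apply, add_comm]
  refine ⟨_, Reaches.single hU (by
    simp only [prog, Code.eval_ops, Code.eval_shifts, Code.eval_jump, Dir.delta]
    rw [show q + ((M.blockSize - 1 : ℕ) : ℤ) * -1 = q + 1 - M.blockSize by omega]),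
    ⟨?_, ?_, ?_⟩, fun i hi => ?_⟩
  all_goals rw [h₂]
  · rw [if_neg (by omega), if_neg (by omega), if_pos (by omega)]
  · rw [if_neg (by omega), if_pos (by omega)]
  · rw [if_pos (by omega)]
  · rw [if_neg (by omega), if_neg (by omega), if_neg (by omega)]

theorem reaches_rewind {A : ℤ → K} {p h : ℤ} {us : List K} {m : K → Prop}
    (hus : Blks M.blockSize m A p us h) (hp : A p = 0) (hU : Set.Icc p h ⊆ U) :
    ∃ A', M.Reaches U (us.length + 1) (some .rewind, A, h) (some (.fetch false), A', p) ∧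
      Blks M.blockSize m A' p us h ∧ ∀ i, i ≤ p ∨ h + 2 < i → A' i = A i := by
  have hB := M.five_le_blockSize
  induction us using List.reverseRecOn generalizing h A with
  | nil =>
      obtain rfl : p = h := hus
      obtain ⟨A', h₁, -, h₂⟩ := eval_flagTest ord (i := 0)
        (.shifts .right M.blockSize (.jump (some .rewind)))
        (.jump (some (Label.fetch (Q := Q) false))) A p (by omega)
      exact ⟨A', .single (hU (by simp)) (h₂ (by simpa using hp) zero_ne_one), rfl,
        fun i hi => h₁ i (by omega) (by omega)⟩
  | append_singleton us u ih =>
      obtain ⟨hus, hu⟩ := hus.of_append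
      have hle := hus.le'
      obtain ⟨A', h₁, h₂, -⟩ := eval_flagTest ord (i := 0)
        (.shifts .right M.blockSize (.jump (some .rewind)))
        (.jump (some (Label.fetch (Q := Q) false))) A h (by omega)
      obtain ⟨A'', r₁, r₂, r₃⟩ := ih (A := A')
        (hus.congr hB fun i _ hi => h₁ i (by omega) (by omega))
        (by rw [h₁ _ (by omega) (by omega), hp])
        ((Set.Icc_subset_Icc le_rfl (by omega)).trans hU)
      refine ⟨A'', (r₁.head (hU (by simp; omega)) ((h₂ ?_).trans ?_)).mono (by simp),
        r₂.append (.single (hu.congr ?_ ?_ ?_) (by ring)), fun i hi => ?_⟩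
      · rw [← hu.flag]; congr 1; ring
      · simp [Dir.delta, sub_eq_add_neg]
      all_goals rw [r₃ _ (by omega), h₁ _ (by omega) (by omega)]

/-- The state between two rounds of unpacking: from `p` to `q` there are blocks for `vs`, and `xs`
is still to be unpacked. -/
structure Unpacking (B : ℕ) (A : ℤ → K) (p q : ℤ) (vs xs : List K) : Prop where
  zero_of_lt : ∀ i, i < p - xs.length → A i = 0
  ones : ∀ i, p - xs.length ≤ i → i < p → A i = 1
  sep : A p = 0
  blocks : (vs = [] ∧ p = q) ∨
    ∃ ws w, vs = ws ++ [w] ∧ Blks B (· = 0) A p ws (q - B) ∧ Blk B (· = 1) A (q - B) w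
  rest : ∀ (j : ℕ) (h : j < xs.length), A (q + 1 + j) = xs[j]
  zero_of_gt : ∀ i, q + xs.length < i → A i = 0

omit [Nontrivial K] in
theorem Unpacking.le {B : ℕ} {A : ℤ → K} {p q : ℤ} {vs xs : List K}
    (h : Unpacking B A p q vs xs) : q = p + vs.length * B := by
  rcases h.blocks with ⟨rfl, rfl⟩ | ⟨ws, w, rfl, h, -⟩
  · simp
  · have := h.le
    simp only [List.length_append, List.length_singleton]
    push_cast
    linarith

/-- The ones are crossed in both directions and changed only at the two ends. Nothing to the right
of `p` is touched, so blocks and remaining input persist. The summand `M.blockSize` in the time is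
due to the ones added before the way back. -/
theorem reaches_grow {A : ℤ → K} {p q : ℤ} {vs xs : List K} {x : K}
    (h : Unpacking M.blockSize A p q vs (x :: xs))
    (hU : Set.Icc (p - xs.length - M.blockSize) p ⊆ U) (e : Bool) :
    ∃ A', M.Reaches U (2 * xs.length + M.blockSize + 4) (some (.fetch e), A, p)
        (some (if e then .append else .moveLeft), A', p) ∧
      (∀ i, i < p + 1 - M.blockSize - xs.length → A' i = 0) ∧
      (∀ i, p + 1 - M.blockSize - xs.length ≤ i → i < p + 1 - M.blockSize → A' i = 1) ∧
      A' (p + 1 - M.blockSize) = 0 ∧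
      ∀ i, p < i → A' i = A i := by
  have hB := M.five_le_blockSize
  have hlen : ((x :: xs).length : ℤ) = xs.length + 1 := by simp
  have h1 := h.ones
  have h0 := h.zero_of_lt
  rw [hlen] at h1 h0
  -- The zero directly to the left of the `xs.length + 1` ones.
  set lo := p - xs.length - 2 with hlo
  have s₁ : M.Reaches U 1 (some (.fetch e), A, p) (some (.growLeft e), A, p - 3) := by
    refine .single (hU (by simp; omega)) ?_
    simp only [prog, Code.eval_shifts]
    rw [(eval_isOne ord _ _ (.inl ⟨rfl, rfl⟩) ?_).1]
    · simp [Dir.delta]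
      ring
    · exact h1 _ (by simp [Dir.delta]; omega) (by simp [Dir.delta]; omega)
    · rw [← h.sep]
      simp [Dir.delta]
  have s₂ := reaches_walkLeft (U := U) (M := M) (l := .growLeft e) rfl (A := A) (lo := lo)
    (w := p - 3) (by omega) (fun i _ _ => h1 i (by omega) (by omega)) (h0 _ (by omega))
    (fun i hi => hU (by simp at hi ⊢; omega))
  simp only [Code.eval_ops, Code.eval_jump] at s₂
  set A₁ := execs (fill (4 - (M.blockSize : ℤ)) (M.blockSize - 2) 1) A (lo - 1) with hA₁
  have hA₁' := execs_fill (4 - (M.blockSize : ℤ)) (M.blockSize - 2) (1 : K) A (lo - 1)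
  rw [← hA₁] at hA₁'
  have s₃ := reaches_walkRight (U := U) (M := M) (l := .growRight e) rfl (A := A₁) (p := p)
    (w := lo - 1) (by omega) (fun i _ _ => by
      rw [hA₁']
      split_ifs
      · rfl
      · exact h1 i (by omega) (by omega)) (by rw [hA₁', if_neg (by omega), h.sep])
    (fun i hi => hU (by simp at hi ⊢; omega))
  simp only [Code.eval_ops, Code.eval_shifts, Code.eval_jump] at s₃
  set A₂ := execs (fill (3 - (M.blockSize : ℤ)) (M.blockSize - 1) 0) A₁ (p - 2) with hA₂
  have hA₂' := execs_fill (3 - (M.blockSize : ℤ)) (M.blockSize - 1) (0 : K) A₁ (p - 2)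
  rw [← hA₂] at hA₂'
  rw [show p - 2 + ((2 : ℕ) : ℤ) * Dir.left.delta = p by simp [Dir.delta]] at s₃
  refine ⟨A₂, ((s₁.trans s₂).trans s₃).mono (by omega), fun i hi => ?_, fun i hi hi' => ?_, ?_,
    fun i hi => ?_⟩
  · rw [hA₂', if_neg (by omega), hA₁', if_neg (by omega), h0 i (by omega)]
  · rw [hA₂', if_neg (by omega), hA₁']
    split_ifs
    · rfl
    · exact h1 i (by omega) (by omega)
  · rw [hA₂', if_pos (by omega)]
  · rw [hA₂', if_neg (by omega), hA₁', if_neg (by omega)]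

/-- The new block needs `B` cells: `B - 1` are gained from the row of ones, and the last one is the
cell of `x` itself. Every phase passes the ones or the blocks a bounded number of times. -/
theorem reaches_unpack_round {A : ℤ → K} {p q : ℤ} {vs xs : List K} {x : K}
    (h : Unpacking M.blockSize A p q vs (x :: xs))
    (hU : Set.Icc (p - xs.length - M.blockSize) (q + 1) ⊆ U) :
    ∃ A', M.Reaches U (2 * (xs.length + vs.length) + M.blockSize + 7)
        (some (.fetch vs.isEmpty), A, p) (some (.fetch false), A', p + 1 - M.blockSize) ∧
      Unpacking M.blockSize A' (p + 1 - M.blockSize) (q + 1) (vs ++ [x]) xs := by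
  have hB := M.five_le_blockSize
  have hpq : p ≤ q := by rw [h.le]; exact le_add_of_nonneg_right (by positivity)
  have hlen : ((x :: xs).length : ℤ) = xs.length + 1 := by simp
  obtain ⟨A₁, s₁, a₁, a₂, a₃, a₄⟩ := reaches_grow h
    ((Set.Icc_subset_Icc le_rfl (by omega)).trans hU) vs.isEmpty
  obtain ⟨A₂, s₂, b₁, b₂⟩ : ∃ A₂, M.Reaches U vs.length
      (some (if vs.isEmpty then .append else .moveLeft), A₁, p) (some .append, A₂, q) ∧
      Blks M.blockSize (· = 0) A₂ (p + 1 - M.blockSize) vs (q + 1 - M.blockSize) ∧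
      ∀ i, i ≤ p + 1 - M.blockSize ∨ q < i → A₂ i = A₁ i := by
    rcases h.blocks with ⟨rfl, rfl⟩ | ⟨ws, w, rfl, hws, hw⟩
    · exact ⟨A₁, .refl _, rfl, fun _ _ => rfl⟩
    · have hle := hws.le'
      obtain ⟨A₂, s₂, b₁, b₂⟩ := reaches_moveLeft (U := U) (A := A₁) (p := p + 1 - M.blockSize)
        (h := p) (q := q) (us := []) (w := w) rfl (hws.congr hB fun i hi _ => a₄ i hi)
        (hw.congr (a₄ _ (by omega)) (a₄ _ (by omega)) (a₄ _ (by omega)))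
        ((Set.Icc_subset_Icc (by omega) (by omega)).trans hU)
      exact ⟨A₂, by simpa using s₂, b₁, b₂⟩
  obtain ⟨A₃, s₃, c₁, c₂⟩ := reaches_append (M := M) (A := A₂) (q := q)
    (hU (show q ∈ _ by simp; omega))
  have hle := b₁.le'
  obtain ⟨A₄, s₄, d₁, d₂⟩ := reaches_rewind (U := U) (b₁.congr (A' := A₃) hB fun i _ hi => c₂ i (.inl hi))
    (by rw [c₂ _ (by omega), b₂ _ (by omega), a₃])
    ((Set.Icc_subset_Icc (by omega) (by omega)).trans hU)
  have e₁ : ∀ i, i ≤ p + 1 - M.blockSize → A₄ i = A₁ i := fun i hi => by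
    rw [d₂ _ (by omega), c₂ _ (by omega), b₂ _ (by omega)]
  have e₂ : ∀ i, q + 1 < i → A₄ i = A i := fun i hi => by
    rw [d₂ _ (by omega), c₂ _ (by omega), b₂ _ (by omega), a₄ _ (by omega)]
  have e₃ : A₂ (q + 1) = x := by
    rw [b₂ _ (by omega), a₄ _ (by omega)]
    have := h.rest 0 (by simp)
    rw [List.getElem_cons_zero] at this
    simpa using this
  refine ⟨A₄, (((s₁.trans s₂).trans s₃).trans s₄).mono (by omega), ?_, ?_, ?_, ?_, ?_, ?_⟩
  · exact fun i hi => by rw [e₁ i (by omega), a₁ i (by omega)]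
  · exact fun i hi hi' => by rw [e₁ i (by omega), a₂ i (by omega) (by omega)]
  · rw [e₁ _ le_rfl, a₃]
  · refine .inr ⟨vs, x, rfl, d₁, ?_⟩
    rw [← e₃]
    exact c₁.congr (d₂ _ (by omega)) (d₂ _ (by omega)) (d₂ _ (by omega))
  · intro j hj
    rw [e₂ _ (by omega)]
    have := h.rest (j + 1) (by simpa using hj)
    rw [List.getElem_cons_succ] at this
    rw [← this]
    congr 1
    push_cast
    ring
  · exact fun i hi => by rw [e₂ i (by omega), h.zero_of_gt i (by omega)]

/-- A round moves one element from `xs` to `vs`, so `xs.length + vs.length` is constant and gives a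
bound common to all rounds. -/
theorem reaches_unpack {A : ℤ → K} {p q : ℤ} {vs xs : List K}
    (h : Unpacking M.blockSize A p q vs xs)
    (hU : Set.Icc (p - (M.blockSize + 1) * xs.length - 2) (q + xs.length) ⊆ U) :
    ∃ A', M.Reaches U (xs.length * (2 * (xs.length + vs.length) + M.blockSize + 7))
        (some (.fetch vs.isEmpty), A, p)
        (some (.fetch (vs ++ xs).isEmpty), A', p + xs.length - M.blockSize * xs.length) ∧
      Unpacking M.blockSize A' (p + xs.length - M.blockSize * xs.length) (q + xs.length)
        (vs ++ xs) [] := by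
  have hB := M.five_le_blockSize
  induction xs generalizing A p q vs with
  | nil =>
      refine ⟨A, ?_, by simpa using h⟩
      simpa using Reaches.refl _
  | cons x xs ih =>
      have hpq : p ≤ q := by rw [h.le]; exact le_add_of_nonneg_right (by positivity)
      have hlen : ((x :: xs).length : ℤ) = xs.length + 1 := by simp
      have hnn : 0 ≤ (M.blockSize : ℤ) * xs.length := by positivity
      rw [hlen] at hU ⊢
      obtain ⟨A₁, s₁, h₁⟩ := reaches_unpack_round h (U := U) (fun i hi => hU (by
        simp only [Set.mem_Icc] at hi ⊢
        constructor
        · linarith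
        · omega))
      obtain ⟨A₂, s₂, h₂⟩ := ih h₁ ((Set.Icc_subset_Icc (by linarith) (by omega)).trans hU)
      rw [List.append_assoc, List.singleton_append] at s₂ h₂
      rw [show p + 1 - M.blockSize + xs.length - M.blockSize * xs.length =
        p + (xs.length + 1) - M.blockSize * (xs.length + 1 : ℤ) by ring] at s₂ h₂
      rw [show (vs ++ [x]).isEmpty = false by simp] at s₂
      refine ⟨A₂, (s₁.trans s₂).mono ?_, by convert h₂ using 1; ring⟩
      simp only [List.length_append, List.length_cons, List.length_nil]
      nlinarith

end KTM

namespace KTM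

variable {K : Type*} [Semiring K] {ord : Option (SemiringOrder K)}
  {Q R Γ : Type*} [Finite Q] [Finite R] [Finite Γ] {M : KTM ord Q R Γ} {U : Set ℤ}
  [Nontrivial K]

/-! ### Packing the output -/

-- The final state is left as an evaluation of the `seek` code at `q`, so that the two ways to go
-- on, for empty and nonempty output, can be separated later.
omit [Nontrivial K] in
theorem reaches_seek {A : ℤ → K} {h q : ℤ} {ys : List K} (e : Bool)
    (hys : Blks M.blockSize (fun _ => True) A h ys q) (hq : A (q + M.blockSize) = 0)
    (hU : Set.Icc h q ⊆ U) :
    ∃ A', M.Reaches U (ys.length + 1) (some (.seek e), A, h)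
        ((M.prog (.seek (e && ys.isEmpty))).eval ord A' q) ∧
      Blks M.blockSize (· = 0) A' h ys q ∧ A' (q + M.blockSize) = 0 ∧ ∀ i, i ≤ h → A' i = A i := by
  have hB := M.five_le_blockSize
  induction ys generalizing h A e with
  | nil =>
      obtain rfl : h = q := hys
      exact ⟨A, .single (hU (by simp)) (by simp), rfl, hq, fun _ _ => rfl⟩
  | cons y ys ih =>
      obtain ⟨hy, hys⟩ := hys
      have hle := hys.le'
      obtain ⟨A₁, h₁, h₂, -⟩ := eval_flagTest ord (i := M.blockSize)
        (.ops [.const 4 0] (.shifts .left M.blockSize (.jump (some (.seek false)))))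
        (if e then .jump none else
          .shifts .right M.blockSize (.ops [.const 4 1] (.jump (some (Label.emit (Q := Q)))))) A h
        (by omega)
      replace h₂ := h₂ (by rw [← hy.flag, add_comm])
      simp only [Code.eval_ops, Code.eval_shifts, Code.eval_jump, Dir.delta, mul_one, execs_cons,
        execs_nil, CompInstr.exec_const] at h₂
      set A₂ := Function.update A₁ (4 + h) 0 with hA₂
      have h₃ : ∀ i, i ≠ 1 + h → i ≠ 2 + h → i ≠ 4 + h → A₂ i = A i := fun i g₁ g₂ g₃ => by
        rw [hA₂, Function.update_of_ne g₃, h₁ i g₁ g₂]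
      obtain ⟨A₃, s, r₁, r₂, r₃⟩ := ih (A := A₂) false
        (hys.congr hB fun i _ _ => h₃ i (by omega) (by omega) (by omega))
        (by rw [h₃ _ (by omega) (by omega) (by omega), hq])
        ((Set.Icc_subset_Icc (by omega) le_rfl).trans hU)
      refine ⟨A₃, ?_, ⟨⟨?_, ?_, ?_⟩, r₁⟩, r₂, fun i hi => ?_⟩
      · simpa using s.head (hU (by simp; omega)) h₂
      · rw [r₃ _ (by omega), h₃ _ (by omega) (by omega) (by omega), hy.val]
      · rw [r₃ _ (by omega), hA₂, add_comm, Function.update_self]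
      · rw [r₃ _ (by omega), h₃ _ (by omega) (by omega) (by omega), hy.flag]
      · rw [r₃ _ (by omega), h₃ _ (by omega) (by omega) (by omega)]

/-- The state between two rounds of packing: from `p` to `q` there are blocks for `vs` and `v`, and
`zs` has already been packed. -/
structure Packing (B : ℕ) (A : ℤ → K) (p q : ℤ) (vs : List K) (v : K) (zs : List K) : Prop where
  zero : A (p - zs.length - 1) = 0
  ones : ∀ i, p - zs.length ≤ i → i < p → A i = 1
  sep : A p = 0
  blocks : Blks B (· = 0) A p vs (q - B)
  last : Blk B (· = 1) A (q - B) v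
  rest : ∀ (j : ℕ) (h : j < zs.length), A (q + 1 + j) = zs[j]

omit [Nontrivial K] in
theorem reaches_emit {A : ℤ → K} {h : ℤ} (hU : h ∈ U) :
    ∃ A', M.Reaches U 1 (some .emit, A, h) (some (.moveRight true), A', h) ∧
      A' (h + M.blockSize) = A (h + 3) ∧ ∀ i, i ≠ h + M.blockSize → A' i = A i := by
  have hB := M.five_le_blockSize
  have h₁ := execs_copy (d := M.blockSize) (s := 3) (by omega) A h
  refine ⟨execs (copy M.blockSize 3) A h, .single hU (by rw [prog, Code.eval_ops, Code.eval_jump]),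
    ?_, fun i hi => ?_⟩
  · rw [h₁, add_comm, Function.update_self, add_comm]
  · rw [h₁, Function.update_of_ne (by omega)]

omit [Nontrivial K] in
theorem reaches_moveRight_single {A : ℤ → K} {h : ℤ} {v : K} (e : Bool)
    (hv : Blk M.blockSize (· = 0) A (h - M.blockSize) v) (hU : h ∈ U) :
    ∃ A', M.Reaches U 1 (some (.moveRight e), A, h)
        (some (.moveRight false), A', h - M.blockSize) ∧
      Blk M.blockSize (· = if e then 1 else 0) A' (h - 1) v ∧
      ∀ i, i ≤ h ∨ h + M.blockSize ≤ i → A' i = A i := by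
  have hB := M.five_le_blockSize
  obtain ⟨A₁, h₁, h₂, -⟩ := eval_flagTest ord (i := 0)
      (.ops (.const 3 (if e then 1 else 0) ::
        copy 2 (3 - M.blockSize) ++ [.const (M.blockSize - 1) 1])
        (.shifts .right M.blockSize (.jump (some (.moveRight false)))))
      (.ops (fill 0 (M.blockSize - 1) 1 ++ [.const (M.blockSize - 1) 0])
        (.shifts .right 2 (.jump (some (Label.shrinkLeft (Q := Q) e))))) A h (by omega)
  replace h₂ := h₂ (by rw [← hv.flag]; congr 1; ring)
  rw [Code.eval_ops, Code.eval_shifts, Code.eval_jump] at h₂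
  set A₂ := execs (.const 3 (if e then 1 else 0) ::
        copy 2 (3 - (M.blockSize : ℤ)) ++ [.const ((M.blockSize : ℤ) - 1) 1]) A₁ h with hA₂
  have h₃ : ∀ i, A₂ i = if i = M.blockSize - 1 + h then 1 else if i = 2 + h then
      A (h - M.blockSize + 3) else if i = 3 + h then (if e then 1 else 0) else A₁ i := by
    intro i
    rw [hA₂, List.cons_append, execs_cons, execs_append, execs_copy (by omega)]
    simp only [execs_cons, execs_nil, CompInstr.exec_const, Function.update_apply]
    rw [if_neg (show 3 - (M.blockSize : ℤ) + h ≠ 3 + h by omega), h₁ _ (by omega) (by omega),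
      show 3 - (M.blockSize : ℤ) + h = h - M.blockSize + 3 by ring]
  refine ⟨A₂, .single hU (h₂.trans ?_), ⟨?_, ?_, ?_⟩, fun i hi => ?_⟩
  · simp [Dir.delta, sub_eq_add_neg]
  all_goals rw [h₃]
  · rw [if_neg (by omega), if_pos (by omega), hv.val]
  · rw [if_neg (by omega), if_neg (by omega), if_pos (by omega)]
  · rw [if_pos (by omega)]
  · rw [if_neg (by omega), if_neg (by omega), if_neg (by omega), h₁ _ (by omega) (by omega)]

-- The mirror image of `reaches_moveLeft`: blocks now move right, so the last one goes first. A move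
-- changes only cells strictly between `h` and `h + B`, before the blocks already moved.
omit [Nontrivial K] in
theorem reaches_moveRight {A : ℤ → K} {p h q : ℤ} {us ws : List K}
    (hus : Blks M.blockSize (· = 0) A p us h)
    (hws : Blks M.blockSize (· = 0) A (h + M.blockSize - 1) ws q) (hU : Set.Icc p h ⊆ U) :
    ∃ A', M.Reaches U us.length (some (.moveRight false), A, h) (some (.moveRight false), A', p) ∧
      Blks M.blockSize (· = 0) A' (p + M.blockSize - 1) (us ++ ws) q ∧
      ∀ i, i ≤ p ∨ h + M.blockSize ≤ i → A' i = A i := by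
  have hB := M.five_le_blockSize
  induction us using List.reverseRecOn generalizing h A ws with
  | nil =>
      obtain rfl : p = h := hus
      exact ⟨A, .refl _, hws, fun _ _ => rfl⟩
  | append_singleton us u ih =>
      obtain ⟨hus, hu⟩ := hus.of_append
      have hle := hus.le'
      obtain ⟨A₁, s₁, h₁, h₂⟩ := reaches_moveRight_single (U := U) false hu (hU (by simp; omega))
      obtain ⟨A₂, s₂, r₁, r₂⟩ := ih (A := A₁) (ws := u :: ws)
        (hus.congr hB fun i _ _ => h₂ i (by omega))
        (by
          rw [show h - M.blockSize + M.blockSize - 1 = h - 1 by ring]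
          refine ⟨by simpa using h₁, ?_⟩
          rw [show h - 1 + (M.blockSize : ℤ) = h + M.blockSize - 1 by ring]
          exact hws.congr hB fun i _ _ => h₂ i (by omega))
        ((Set.Icc_subset_Icc le_rfl (by omega)).trans hU)
      refine ⟨A₂, (s₁.trans s₂).mono (by simp; omega), by simpa using r₁, fun i hi => ?_⟩
      rw [r₂ i (by omega), h₂ i (by omega)]

/-- The counterpart of `reaches_grow`. The `B - 1` cells from `p` on have become free; they turn
into ones, `p + B - 1` becomes the separator, and erasing `B - 2` ones on the left leaves `k + 1`.
-/
theorem reaches_shrink {A : ℤ → K} {p : ℤ} {k : ℕ} (e : Bool) (hz : A (p - k - 1) = 0)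
    (ho : ∀ i, p - k ≤ i → i < p → A i = 1) (hp : A p = 0)
    (hU : Set.Icc (p - k - 2) (p + M.blockSize) ⊆ U) :
    ∃ A', M.Reaches U (2 * k + M.blockSize + 5) (some (.moveRight e), A, p)
        (if e then none else some .advance, A', p + M.blockSize - 1) ∧
      A' (p + M.blockSize - 1 - k - 2) = 0 ∧
      (∀ i, p + M.blockSize - 1 - (k + 1) ≤ i → i < p + M.blockSize - 1 → A' i = 1) ∧
      A' (p + M.blockSize - 1) = 0 ∧ ∀ i, p + M.blockSize ≤ i → A' i = A i := by
  have hB := M.five_le_blockSize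
  obtain ⟨A₁, h₁, -, h₂⟩ := eval_flagTest ord (i := 0)
      (.ops (.const 3 (if e then 1 else 0) ::
        copy 2 (3 - M.blockSize) ++ [.const (M.blockSize - 1) 1])
        (.shifts .right M.blockSize (.jump (some (.moveRight false)))))
      (.ops (fill 0 (M.blockSize - 1) 1 ++ [.const (M.blockSize - 1) 0])
        (.shifts .right 2 (.jump (some (Label.shrinkLeft (Q := Q) e))))) A p (by omega)
  replace h₂ := h₂ (by rw [zero_add, hp]) zero_ne_one
  rw [Code.eval_ops, Code.eval_shifts, Code.eval_jump,
    show p + ((2 : ℕ) : ℤ) * Dir.right.delta = p - 2 by simp [Dir.delta, sub_eq_add_neg]] at h₂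
  set A₂ := execs (fill 0 (M.blockSize - 1) 1 ++ [.const ((M.blockSize : ℤ) - 1) 0]) A₁ p with hA₂
  have h₃ : ∀ i, A₂ i = if i = M.blockSize - 1 + p then 0 else if 0 + p ≤ i ∧
      i < 0 + (M.blockSize - 1 : ℕ) + p then 1 else A₁ i := by
    intro i
    rw [hA₂, execs_append]
    simp only [execs_cons, execs_nil, CompInstr.exec_const, Function.update_apply, execs_fill]
  have s₁ : M.Reaches U 1 (some (.moveRight e), A, p) (some (.shrinkLeft e), A₂, p - 2) :=
    .single (hU (by simp; omega)) h₂
  have hone : ∀ i, p - k ≤ i → i < p + M.blockSize - 1 → A₂ i = 1 := fun i g₁ g₂ => by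
    rw [h₃, if_neg (by omega)]
    split_ifs
    · rfl
    · rw [h₁ _ (by omega) (by omega), ho i (by omega) (by omega)]
  have s₂ := reaches_walkLeft (U := U) (M := M) (l := .shrinkLeft e) rfl (A := A₂)
    (lo := p - k - 1) (w := p - 2) (by omega) (fun i _ _ => hone i (by omega) (by omega))
    (by rw [h₃, if_neg (by omega), if_neg (by omega), h₁ _ (by omega) (by omega), hz])
    (fun i hi => hU (by simp at hi ⊢; omega))
  rw [Code.eval_ops, Code.eval_shifts, Code.eval_jump,
    show p - k - 1 - 1 + ((M.blockSize - 1 : ℕ) : ℤ) * Dir.left.delta = p + M.blockSize - k - 3 by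
      simp only [Dir.delta, mul_one]; omega] at s₂
  set A₃ := execs (fill 2 (M.blockSize - 2) 0) A₂ (p - k - 1 - 1) with hA₃
  have h₄ := execs_fill 2 (M.blockSize - 2) (0 : K) A₂ (p - k - 1 - 1)
  rw [← hA₃] at h₄
  have hsep : A₃ (p + M.blockSize - 1) = 0 := by
    rw [h₄, if_neg (by omega), h₃, if_pos (by omega)]
  have hone' : ∀ i, p + M.blockSize - 1 - (k + 1) ≤ i → i < p + M.blockSize - 1 → A₃ i = 1 :=
    fun i g₁ g₂ => by rw [h₄, if_neg (by omega), hone i (by omega) (by omega)]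
  have s₃ := reaches_walkRight (U := U) (M := M) (l := .shrinkRight e) rfl (A := A₃)
    (p := p + M.blockSize - 1) (w := p + M.blockSize - k - 3) (by omega)
    (fun i _ _ => hone' i (by omega) (by omega)) hsep (fun i hi => hU (by simp at hi ⊢; omega))
  rw [Code.eval_shifts, Code.eval_jump, show p + M.blockSize - 1 - 2 +
    ((2 : ℕ) : ℤ) * Dir.left.delta = p + M.blockSize - 1 by simp [Dir.delta]] at s₃
  refine ⟨A₃, ((s₁.trans s₂).trans s₃).mono (by omega), ?_, hone', hsep, fun i hi => ?_⟩
  · rw [h₄, if_pos (by omega)]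
  · rw [h₄, if_neg (by omega), h₃, if_neg (by omega), if_neg (by omega),
      h₁ _ (by omega) (by omega)]

theorem reaches_advance {A : ℤ → K} {h q : ℤ} {ws : List K} {w : K}
    (hws : Blks M.blockSize (· = 0) A h ws (q - M.blockSize))
    (hw : Blk M.blockSize (· = 1) A (q - M.blockSize) w) (hU : Set.Icc h q ⊆ U) :
    ∃ A', M.Reaches U (ws.length + 1) (some .advance, A, h) (some .emit, A', q - M.blockSize) ∧
      Blks M.blockSize (· = 0) A' h ws (q - M.blockSize) ∧
      Blk M.blockSize (· = 1) A' (q - M.blockSize) w ∧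
      ∀ i, i ≤ h ∨ q < i → A' i = A i := by
  have hB := M.five_le_blockSize
  induction ws generalizing h A with
  | nil =>
      obtain rfl : h = q - M.blockSize := hws
      obtain ⟨A₁, h₁, h₂, -⟩ := eval_flagTest ord (i := 4) (.jump (some .emit))
        (.shifts .left M.blockSize (.jump (some (Label.advance (Q := Q))))) A (q - M.blockSize)
        (by omega)
      refine ⟨A₁, .single (hU (by simp)) (h₂ ?_), rfl, hw.congr ?_ ?_ ?_, fun i hi => ?_⟩
      · rw [← hw.mark, add_comm]
      all_goals exact h₁ _ (by omega) (by omega)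
  | cons v ws ih =>
      obtain ⟨hv, hws⟩ := hws
      have hle := hws.le'
      obtain ⟨A₁, h₁, -, h₂⟩ := eval_flagTest ord (i := 4) (.jump (some .emit))
        (.shifts .left M.blockSize (.jump (some (Label.advance (Q := Q))))) A h
        (by omega)
      replace h₂ := h₂ (by rw [← hv.mark, add_comm]) zero_ne_one
      simp only [Code.eval_shifts, Code.eval_jump, Dir.delta, mul_one] at h₂
      have hc : ∀ i, h + 2 < i → A₁ i = A i := fun i hi => h₁ i (by omega) (by omega)
      obtain ⟨A₂, s, r₁, r₂, r₃⟩ := ih (A := A₁) (hws.congr hB fun i _ _ => hc i (by omega))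
        (hw.congr (hc _ (by omega)) (hc _ (by omega)) (hc _ (by omega)))
        ((Set.Icc_subset_Icc (by omega) le_rfl).trans hU)
      refine ⟨A₂, s.head (hU (by simp; omega)) h₂, ⟨hv.congr ?_ ?_ ?_, r₁⟩, r₂, fun i hi => ?_⟩
      all_goals rw [r₃ _ (by omega), h₁ _ (by omega) (by omega)]

/-- The end of packing. -/
structure Packed (A : ℤ → K) (p : ℤ) (zs : List K) : Prop where
  zero : A (p - zs.length - 1) = 0
  ones : ∀ i, p - zs.length ≤ i → i < p → A i = 1
  rest : ∀ (j : ℕ) (h : j < zs.length), A (p + 1 + j) = zs[j]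

/-- With a single block, `moveRight true` meets the separator at once; the argument `true` is passed
on to `shrinkRight`, which halts. -/
theorem reaches_pack_last {A : ℤ → K} {p q : ℤ} {v : K} {zs : List K}
    (h : Packing M.blockSize A p q [] v zs) (hU : Set.Icc (p - zs.length - 2) q ⊆ U) :
    ∃ A', M.Reaches U (2 * zs.length + M.blockSize + 6) (some .emit, A, p) (none, A', q - 1) ∧
      Packed A' (q - 1) (v :: zs) := by
  have hB := M.five_le_blockSize
  obtain rfl : p = q - M.blockSize := h.blocks
  have hlen : ((v :: zs).length : ℤ) = zs.length + 1 := by simp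
  obtain ⟨A₁, s₁, a₁, a₂⟩ := reaches_emit (M := M) (A := A)
    (hU (show q - (M.blockSize : ℤ) ∈ _ by simp; omega))
  obtain ⟨A₂, s₂, b₁, b₂, b₃, b₄⟩ := reaches_shrink (M := M) (U := U) (A := A₁)
    (p := q - M.blockSize) (k := zs.length) true (by rw [a₂ _ (by omega), h.zero])
    (fun i _ _ => by rw [a₂ _ (by omega), h.ones _ (by omega) (by omega)])
    (by rw [a₂ _ (by omega), h.sep]) ((Set.Icc_subset_Icc (by omega) (by omega)).trans hU)
  rw [sub_add_cancel] at *
  refine ⟨A₂, (s₁.trans s₂).mono (by omega), ?_, ?_, ?_⟩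
  · rw [hlen, ← b₁]; congr 1; ring
  · rw [hlen]; exact b₂
  · intro j hj
    rw [b₄ _ (by omega)]
    rcases j with _ | j
    · rw [List.getElem_cons_zero, ← h.last.val, ← a₁]
      congr 1
      push_cast
      ring
    · have := h.rest j (by simpa using hj)
      rw [List.getElem_cons_succ, ← this, a₂ _ (by omega)]
      congr 1
      push_cast
      ring

/-- Once `v` is in cell `q`, the other `B - 1` cells of its block are free. The remaining blocks
move right by this amount, and the ones follow and increase by one; this is the invariant for `q -
1`. -/
theorem reaches_pack_round {A : ℤ → K} {p q : ℤ} {vs : List K} {u v : K} {zs : List K}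
    (h : Packing M.blockSize A p q (vs ++ [u]) v zs)
    (hU : Set.Icc (p - zs.length - 2) q ⊆ U) :
    ∃ A', M.Reaches U (2 * (zs.length + vs.length) + M.blockSize + 8)
        (some .emit, A, q - M.blockSize) (some .emit, A', q - 1 - M.blockSize) ∧
      Packing M.blockSize A' (p + M.blockSize - 1) (q - 1) vs u (v :: zs) := by
  have hB := M.five_le_blockSize
  have hlen : ((v :: zs).length : ℤ) = zs.length + 1 := by simp
  obtain ⟨hvs, hu⟩ := h.blocks.of_append
  have hle := hvs.le'
  obtain ⟨A₁, s₁, a₁, a₂⟩ := reaches_emit (M := M) (A := A)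
    (hU (show q - (M.blockSize : ℤ) ∈ _ by simp; omega))
  have a₃ : ∀ i, i < q → A₁ i = A i := fun i hi => a₂ i (by omega)
  obtain ⟨A₂, s₂, b₁, b₂⟩ := reaches_moveRight_single (M := M) (U := U) (A := A₁)
    (h := q - M.blockSize) true (hu.congr (a₃ _ (by omega)) (a₃ _ (by omega)) (a₃ _ (by omega)))
    (hU (by simp; omega))
  obtain ⟨A₃, s₃, c₁, c₂⟩ := reaches_moveRight (M := M) (U := U) (A := A₂) (ws := [])
    (hvs.congr hB fun i _ hi => by rw [b₂ _ (by omega), a₃ _ (by omega)]) rfl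
    ((Set.Icc_subset_Icc (by omega) (by omega)).trans hU)
  have c₃ : ∀ i, i ≤ p → A₃ i = A i := fun i hi => by
    rw [c₂ _ (by omega), b₂ _ (by omega), a₃ _ (by omega)]
  have c₄ : ∀ i, q ≤ i → A₃ i = A₁ i := fun i hi => by
    rw [c₂ _ (by omega), b₂ _ (by omega)]
  obtain ⟨A₄, s₄, d₁, d₂, d₃, d₄⟩ := reaches_shrink (M := M) (U := U) (A := A₃)
    (p := p) (k := zs.length) false (by rw [c₃ _ (by omega), h.zero])
    (fun i _ _ => by rw [c₃ _ (by omega), h.ones _ (by omega) (by omega)])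
    (by rw [c₃ _ (by omega), h.sep]) ((Set.Icc_subset_Icc (by omega) (by omega)).trans hU)
  have d₅ : Blks M.blockSize (· = 0) A₄ (p + M.blockSize - 1) vs (q - 1 - M.blockSize) := by
    convert c₁.congr (A' := A₄) hB fun i hi _ => d₄ i (by omega) using 1
    · simp
    · ring
  have d₆ : Blk M.blockSize (· = 1) A₄ (q - 1 - M.blockSize) u := by
    rw [if_pos rfl] at b₁
    have : ∀ i, q - M.blockSize < i → i ≠ q → A₄ i = A₂ i := fun i h₁ h₂ => by
      rw [d₄ _ (by omega), c₂ _ (by omega)]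
    rw [show q - (M.blockSize : ℤ) - 1 = q - 1 - M.blockSize by ring] at b₁
    exact b₁.congr (this _ (by omega) (by omega)) (this _ (by omega) (by omega))
      (this _ (by omega) (by omega))
  obtain ⟨A₅, s₅, e₁, e₂, e₃⟩ := reaches_advance (U := U) d₅ d₆
    ((Set.Icc_subset_Icc (by omega) (by omega)).trans hU)
  refine ⟨A₅, ((((s₁.trans s₂).trans s₃).trans s₄).trans s₅).mono (by omega), ?_, ?_, ?_, e₁, e₂, ?_⟩
  · rw [hlen, e₃ _ (by omega), ← d₁]
    congr 1
    ring
  · intro i hi hi'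
    rw [e₃ _ (by omega), d₂ _ (by omega) (by omega)]
  · rw [e₃ _ (by omega), d₃]
  · intro j hj
    rw [e₃ _ (by omega), d₄ _ (by omega), c₄ _ (by omega)]
    rcases j with _ | j
    · rw [List.getElem_cons_zero, ← h.last.val]
      rw [sub_add_cancel] at a₁
      rw [← a₁]
      congr 1
      push_cast
      ring
    · have := h.rest j (by simpa using hj)
      rw [List.getElem_cons_succ, ← this, a₂ _ (by push_cast; omega)]
      congr 1
      push_cast
      ring

theorem reaches_pack {A : ℤ → K} {p q : ℤ} {vs : List K} {v : K} {zs : List K}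
    (h : Packing M.blockSize A p q vs v zs) (hU : Set.Icc (p - zs.length - 2) q ⊆ U) :
    ∃ A' o, M.Reaches U ((vs.length + 1) * (2 * (zs.length + vs.length) + M.blockSize + 8))
        (some .emit, A, q - M.blockSize) (none, A', o) ∧ Packed A' o (vs ++ v :: zs) := by
  have hB := M.five_le_blockSize
  induction vs using List.reverseRecOn generalizing A p q v zs with
  | nil =>
      obtain ⟨A', s, h'⟩ := reaches_pack_last h hU
      obtain rfl : p = q - M.blockSize := h.blocks
      exact ⟨A', _, s.mono (by simp), h'⟩
  | append_singleton vs u ih =>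
      have hlen : ((v :: zs).length : ℤ) = zs.length + 1 := by simp
      obtain ⟨A₁, s₁, h₁⟩ := reaches_pack_round h hU
      obtain ⟨A₂, o, s₂, h₂⟩ := ih h₁
        ((Set.Icc_subset_Icc (by rw [hlen]; omega) (by omega)).trans hU)
      refine ⟨A₂, o, (s₁.trans s₂).mono ?_, by simpa using h₂⟩
      simp only [List.length_append, List.length_cons, List.length_nil]
      nlinarith

theorem reaches_unload {A : ℤ → K} {o q : ℤ} {ys : List K}
    (hys : Blks M.blockSize (fun _ => True) A o ys q) (hq : A (q + M.blockSize) = 0)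
    (hU : Set.Icc (o - 2) q ⊆ U) :
    ∃ A' o', M.Reaches U ((ys.length + 1) * (2 * ys.length + M.blockSize + 10))
        (some .unload, A, o) (none, A', o') ∧ Packed A' o' ys := by
  have hB := M.five_le_blockSize
  have hle := hys.le'
  have h₁ : ∀ i, execs [.const 0 0, .const (-1) 0] A o i =
      if i = -1 + o then 0 else if i = o then 0 else A i := by
    simp [Function.update_apply]
  have s₁ : M.Reaches U 1 (some .unload, A, o)
      (some (.seek true), execs [.const 0 0, .const (-1) 0] A o, o) :=
    .single (hU (by simp; omega)) (by rw [prog, Code.eval_ops, Code.eval_jump])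
  obtain ⟨A₂, s₂, b₁, b₂, b₃⟩ := reaches_seek (M := M) (U := U) true
    (hys.congr (A' := execs [.const 0 0, .const (-1) 0] A o) hB fun i _ _ => by
      rw [h₁, if_neg (by omega), if_neg (by omega)])
    (by rw [h₁, if_neg (by omega), if_neg (by omega), hq])
    ((Set.Icc_subset_Icc (by omega) le_rfl).trans hU)
  rw [Bool.true_and] at s₂
  obtain ⟨A₃, c₁, -, c₂⟩ := eval_flagTest ord (i := M.blockSize)
    (.ops [.const 4 0] (.shifts .left M.blockSize (.jump (some (.seek false)))))
    (if ys.isEmpty then .jump none else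
      .shifts .right M.blockSize (.ops [.const 4 1] (.jump (some (Label.emit (Q := Q)))))) A₂ q
    (by omega)
  replace c₂ := c₂ (by rw [← b₂, add_comm]) zero_ne_one
  rw [prog, c₂] at s₂
  -- For empty output the program halts here, and the zero at `o - 1` encodes length zero.
  rcases List.eq_nil_or_concat ys with rfl | ⟨vs, v, rfl⟩
  · obtain rfl : o = q := hys
    refine ⟨A₃, o, (s₁.trans s₂).mono (by simp), ?_, ?_, ?_⟩
    · rw [c₁ _ (by simp; omega) (by simp; omega), b₃ _ (by simp), h₁, if_pos (by simp; ring)]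
    · intro i hi hi'
      simp at hi
      omega
    · intro j hj
      simp at hj
  · rw [List.concat_eq_append] at *
    obtain ⟨hvs, hv⟩ := b₁.of_append
    have hle' := hvs.le'
    rw [show (vs ++ [v]).isEmpty = false by simp] at s₂
    simp only [Bool.false_eq_true, if_false, Code.eval_shifts, Code.eval_ops, Code.eval_jump,
      Dir.delta, mul_neg, mul_one, ← sub_eq_add_neg, execs_cons, execs_nil,
      CompInstr.exec_const] at s₂
    set A₄ := Function.update A₃ (4 + (q - (M.blockSize : ℤ))) 1 with hA₄
    have d₁ : ∀ i, i ≤ q → i ≠ q - M.blockSize + 4 → A₄ i = A₂ i := fun i h₁ h₂ => by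
      rw [hA₄, Function.update_of_ne (by omega), c₁ _ (by omega) (by omega)]
    have hp : Packing M.blockSize A₄ o q vs v [] := by
      refine ⟨?_, ?_, ?_, hvs.congr hB fun i _ _ => d₁ _ (by omega) (by omega), ⟨?_, ?_, ?_⟩, ?_⟩
      · rw [d₁ _ (by simp; omega) (by simp; omega), b₃ _ (by simp), h₁, if_pos (by simp; ring)]
      · intro i hi hi'
        simp at hi
        omega
      · rw [d₁ _ (by omega) (by omega), b₃ _ le_rfl, h₁, if_neg (by omega), if_pos rfl]
      · rw [d₁ _ (by omega) (by omega), hv.val]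
      · rw [hA₄, add_comm, Function.update_self]
      · rw [d₁ _ (by omega) (by omega), hv.flag]
      · intro j hj
        simp at hj
    obtain ⟨A₅, o', s₃, h₅⟩ := reaches_pack hp (U := U)
      ((Set.Icc_subset_Icc (by simp) le_rfl).trans hU)
    refine ⟨A₅, o', ((s₁.trans s₂).trans s₃).mono ?_, h₅⟩
    simp only [List.length_append, List.length_cons, List.length_nil]
    nlinarith

end KTM

namespace KTM

variable {K : Type*} [Semiring K] {ord : Option (SemiringOrder K)}
  {Q R Γ : Type*} [Finite Q] [Finite R] [Finite Γ] {M : KTM ord Q R Γ} {U : Set ℤ}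

/-! ### Simulating the steps of a Turing machine -/

open Classical in
/-- The block at `p` represents an element of `Γ ∪ K`. -/
def Encodes (M : KTM ord Q R Γ) (A : ℤ → K) (p : ℤ) : Γ ⊕ K → Prop
  | .inl g => A (M.blockSize + p) = 0 ∧
      ∀ g', A (M.symCoord g' + p) = if g' = g ∧ g ≠ M.b then 1 else 0
  | .inr v => A (M.blockSize + p) = 1 ∧ A (3 + p) = v

/-- Scratch and register coordinates do not belong to the encoding; this is what allows tests, and
registers travelling through the blocks. -/
theorem Encodes.congr {A A' : ℤ → K} {p : ℤ} {x : Γ ⊕ K} (h : M.Encodes A p x)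
    (hA : ∀ f : ℤ, 3 ≤ f → f ≤ M.blockSize → (∀ r, f ≠ M.regCoord r) → A' (f + p) = A (f + p)) :
    M.Encodes A' p x := by
  have hB := M.five_le_blockSize
  have h₁ : A' (M.blockSize + p) = A (M.blockSize + p) :=
    hA _ (by omega) le_rfl fun r => (M.regCoord_bounds r).2.ne'
  rcases x with g | v
  · refine ⟨h₁.trans h.1, fun g' => ?_⟩
    have h₂ := M.symCoord_bounds g'
    have h₃ : 5 + Nat.card Γ ≤ M.blockSize := by unfold blockSize; omega
    rw [← h.2 g']
    refine hA _ (by omega) (by omega) fun r => ?_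
    have := M.regCoord_bounds r
    omega
  · refine ⟨h₁.trans h.1, (hA _ le_rfl (by omega) fun r => ?_).trans h.2⟩
    have := M.regCoord_bounds r
    omega

/-- The state `A`, seen from offset `o`, represents the registers and the tape. -/
structure Simulates (M : KTM ord Q R Γ) (ρ : R → K) (tape : ℤ → Γ ⊕ K) (A : ℤ → K) (o : ℤ) :
    Prop where
  cells : ∀ i, M.Encodes A (o + M.blockSize * (i - 1)) (tape i)
  regs : ∀ r, A (M.regCoord r + o) = ρ r

/-- Uniqueness of division with remainders `1, …, B`: distinct blocks are disjoint. -/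
theorem eq_of_block_eq {B i j f f' : ℤ} (hf : 1 ≤ f ∧ f ≤ B) (hf' : 1 ≤ f' ∧ f' ≤ B)
    (h : B * i + f = B * j + f') : i = j ∧ f = f' := by
  have hij : i = j := by
    rcases lt_trichotomy i j with h' | h' | h'
    · nlinarith
    · exact h'
    · nlinarith
  subst hij
  exact ⟨rfl, by omega⟩

theorem Simulates.cell_one {ρ : R → K} {tape : ℤ → Γ ⊕ K} {A : ℤ → K} {o : ℤ}
    (h : M.Simulates ρ tape A o) : M.Encodes A o (tape 1) := by
  simpa using h.cells 1

/-- Changes within the current block. -/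
theorem Simulates.update {ρ ρ' : R → K} {tape : ℤ → Γ ⊕ K} {A A' : ℤ → K} {o : ℤ}
    (h : M.Simulates ρ tape A o) {y : Γ ⊕ K} (hy : M.Encodes A' o y)
    (hρ : ∀ r, A' (M.regCoord r + o) = ρ' r)
    (hA : ∀ f : ℤ, f < 1 ∨ M.blockSize < f → A' (f + o) = A (f + o)) :
    M.Simulates ρ' (Function.update tape 1 y) A' o := by
  refine ⟨fun i => ?_, hρ⟩
  rcases eq_or_ne i 1 with rfl | hi
  · simpa using hy
  · rw [Function.update_of_ne hi]
    refine (h.cells i).congr fun f h₁ h₂ _ => ?_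
    have := hA (M.blockSize * (i - 1) + f) (by
      by_contra hc
      have := (eq_of_block_eq (B := M.blockSize) (i := i - 1) (j := 0) (f := f)
        (f' := M.blockSize * (i - 1) + f) (by omega) (by omega) (by ring)).1
      omega)
    rwa [show M.blockSize * (i - 1) + f + o = f + (o + M.blockSize * (i - 1)) by ring] at this

theorem Simulates.congr_scratch {ρ : R → K} {tape : ℤ → Γ ⊕ K} {A A' : ℤ → K} {o : ℤ}
    (h : M.Simulates ρ tape A o) (hA : ∀ i, i ≠ 1 + o → i ≠ 2 + o → A' i = A i) :
    M.Simulates ρ tape A' o := by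
  have hB := M.five_le_blockSize
  have := h.update (A' := A') (ρ' := ρ) (h.cell_one.congr fun f _ _ _ => hA _ (by omega) (by omega))
    (fun r => by
      have := M.regCoord_bounds r
      rw [hA _ (by omega) (by omega), h.regs])
    (fun f _ => hA _ (by omega) (by omega))
  rwa [Function.update_eq_self] at this

theorem Simulates.eval_moveCode {ρ : R → K} {tape : ℤ → Γ ⊕ K} {A : ℤ → K} {o : ℤ}
    (h : M.Simulates ρ tape A o) (l : Option (Label Q)) (mv : Move) :
    ∃ A', (M.moveCode (.jump l) mv).eval ord A o = (l, A', o + M.blockSize * mv.delta) ∧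
      M.Simulates ρ (fun i => tape (i + mv.delta)) A' (o + M.blockSize * mv.delta) := by
  rcases mv with d | _
  · have hd : d.delta = 1 ∨ d.delta = -1 := by cases d <;> simp [Dir.delta]
    have hmv : (Move.shift d).delta = d.delta := rfl
    set l' := M.regList.map fun r => (M.regCoord r + M.blockSize * d.delta, M.regCoord r) with hl'
    have hmem : ∀ a ∈ l', ∃ r, a = (M.regCoord r + M.blockSize * d.delta, M.regCoord r) := by
      intro a ha
      obtain ⟨r, -, rfl⟩ := List.mem_map.1 ha
      exact ⟨r, rfl⟩
    refine ⟨execs (copies l') A o, ?_, ⟨fun i => ?_, fun r => ?_⟩⟩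
    · rw [moveCode, Code.eval_ops, Code.eval_shifts, Code.eval_jump, hmv]
    · have := h.cells (i + d.delta)
      rw [hmv, show o + M.blockSize * d.delta + M.blockSize * (i - 1) =
        o + M.blockSize * (i + d.delta - 1) by ring]
      refine this.congr fun f h₁ h₂ h₃ => execs_copies_of_notMem _ fun a ha he => ?_
      obtain ⟨r, rfl⟩ := hmem a ha
      have hr := M.regCoord_bounds r
      exact h₃ r (eq_of_block_eq (B := M.blockSize) (i := i + d.delta - 1) (j := d.delta)
        (by omega) (by omega) (by linarith)).2
    · have hn : (l'.map Prod.fst).Nodup := by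
        rw [hl', List.map_map]
        refine M.nodup_regList.map fun r r' hr => M.regCoord_injective ?_
        simpa using hr
      have := execs_copies hn (fun a ha b hb => by
        obtain ⟨r, rfl⟩ := hmem a ha
        obtain ⟨r', rfl⟩ := hmem b hb
        have h₁ := M.regCoord_bounds r
        have h₂ := M.regCoord_bounds r'
        rcases hd with hd | hd <;> rw [hd] <;> simp only <;> omega) A o
        (List.mem_map_of_mem (f := fun r => (M.regCoord r + M.blockSize * d.delta, M.regCoord r))
          (M.mem_regList r))
      rw [← h.regs, ← this, hmv]
      congr 1
      ring
  · refine ⟨A, by simp [moveCode, Move.delta], ?_⟩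
    simpa [Move.delta] using h

/-- Among the cells that must not change is coordinate `1`, with the old content that is still to be
stored in registers. -/
theorem eval_writeInstrs {c : M.Config} {A : ℤ → K} {o : ℤ} {z : WriteInstr K R Γ} {y : Γ ⊕ K}
    (h : M.Encodes A o (c.tape 1)) (hr : ∀ r, A (M.regCoord r + o) = c.regs r)
    (hz : M.written c z = some y) :
    M.Encodes (execs (M.writeInstrs z) A o) o y ∧
      ∀ f : ℤ, f ≤ 1 ∨ M.blockSize < f ∨ (∃ r, f = M.regCoord r) →
        execs (M.writeInstrs z) A o (f + o) = A (f + o) := by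
  classical
  have hB := M.five_le_blockSize
  have hG : 5 + Nat.card Γ ≤ M.blockSize := by unfold blockSize; omega
  rcases z with g | k | _ | ⟨op, r⟩
  · cases hz
    set l := ((M.blockSize : ℤ), (0 : K)) ::
      M.symList.map fun g' => (M.symCoord g', if g' = g ∧ g ≠ M.b then 1 else 0) with hl
    have hex : execs (M.writeInstrs (.symbol g)) A o = execs (consts l) A o := by
      rw [writeInstrs, symbolInstrs, hl]
    rw [hex]
    have hn : (l.map Prod.fst).Nodup := by
      rw [hl, List.map_cons, List.map_map, List.nodup_cons]
      refine ⟨fun hm => ?_, M.nodup_symList.map M.symCoord_injective⟩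
      obtain ⟨g', -, hg'⟩ := List.mem_map.1 hm
      have := M.symCoord_bounds g'
      simp only [Function.comp] at hg'
      omega
    refine ⟨⟨execs_consts hn A o List.mem_cons_self, fun g' => ?_⟩, fun f hf => ?_⟩
    · rw [execs_consts hn A o (List.mem_cons_of_mem _ (List.mem_map_of_mem (M.mem_symList g')))]
    · refine execs_consts_of_notMem _ fun a ha he => ?_
      rcases List.mem_cons.1 ha with rfl | ha
      · rcases hf with hf | hf | ⟨r, rfl⟩
        · simp only at he; omega
        · simp only at he; omega
        · have := M.regCoord_bounds r
          simp only at he; omega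
      · obtain ⟨g', -, rfl⟩ := List.mem_map.1 ha
        have := M.symCoord_bounds g'
        rcases hf with hf | hf | ⟨r, rfl⟩
        · simp only at he; omega
        · simp only at he; omega
        · have := M.regCoord_bounds r
          simp only at he; omega
  · cases hz
    have h₁ : ∀ i, execs (M.writeInstrs (.value k)) A o i =
        if i = M.blockSize + o then 1 else if i = 3 + o then k else A i := by
      simp [writeInstrs, Function.update_apply]
    refine ⟨⟨by rw [h₁, if_pos rfl], by rw [h₁, if_neg (by omega), if_pos rfl]⟩, fun f hf => ?_⟩
    rw [h₁]
    rcases hf with hf | hf | ⟨r, rfl⟩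
    · rw [if_neg (by omega), if_neg (by omega)]
    · rw [if_neg (by omega), if_neg (by omega)]
    · have := M.regCoord_bounds r
      rw [if_neg (by omega), if_neg (by omega)]
  · cases hz
    exact ⟨h, fun _ _ => rfl⟩
  · rw [written] at hz
    rcases ht : c.tape 1 with g | a
    · rw [ht] at hz
      simp at hz
    · rw [ht] at hz h
      cases hz
      have h₁ : execs (M.writeInstrs (.arith op r)) A o =
          Function.update A (3 + o) (op.eval a (c.regs r)) := by
        cases op <;> simp [writeInstrs, ArithOp.eval, h.2, hr]
      rw [h₁]
      refine ⟨⟨by rw [Function.update_of_ne (by omega), h.1], Function.update_self ..⟩,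
        fun f hf => Function.update_of_ne ?_ _ _⟩
      rcases hf with hf | hf | ⟨r, rfl⟩
      · omega
      · omega
      · have := M.regCoord_bounds r
        omega

theorem eval_storeInstrs (s : Set R) (A : ℤ → K) (o : ℤ) :
    (∀ r ∈ s, execs (M.storeInstrs s) A o (M.regCoord r + o) = A (1 + o)) ∧
      ∀ f : ℤ, (∀ r ∈ s, f ≠ M.regCoord r) → execs (M.storeInstrs s) A o (f + o) = A (f + o) := by
  classical
  have hl : execs (M.storeInstrs s) A o =
      execs (copies ((M.regList.filter (· ∈ s)).map fun r => (M.regCoord r, 1))) A o := by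
    rw [storeInstrs]
  have hmem : ∀ a ∈ (M.regList.filter (· ∈ s)).map fun r => (M.regCoord r, (1 : ℤ)),
      ∃ r ∈ s, a = (M.regCoord r, 1) := by
    intro a ha
    obtain ⟨r, hr, rfl⟩ := List.mem_map.1 ha
    exact ⟨r, by simpa using (List.mem_filter.1 hr).2, rfl⟩
  rw [hl]
  refine ⟨fun r hr => ?_, fun f hf => execs_copies_of_notMem _ fun a ha => ?_⟩
  · refine execs_copies (a := (M.regCoord r, 1)) ?_ ?_ A o ?_
    · rw [List.map_map]
      exact (M.nodup_regList.filter _).map M.regCoord_injective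
    · intro a ha b hb
      obtain ⟨r, -, rfl⟩ := hmem a ha
      obtain ⟨r', -, rfl⟩ := hmem b hb
      have := M.regCoord_bounds r
      simp only
      omega
    · exact List.mem_map_of_mem (f := fun r => (M.regCoord r, (1 : ℤ)))
        (List.mem_filter.2 ⟨M.mem_regList r, by simpa using hr⟩)
  · obtain ⟨r, hr, rfl⟩ := hmem a ha
    have := hf r hr
    simp only
    omega

theorem Simulates.eval_actCode {c c' : M.Config} {A : ℤ → K} {o : ℤ}
    (h : M.Simulates c.regs c.tape A o) (hc : M.step c = some c') :
    ∃ A', (M.actCode c.state (M.scan c)).eval ord A o =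
        (some (.state c'.state), A', o + M.blockSize * (c'.offset - c.offset)) ∧
      M.Simulates c'.regs c'.tape A' (o + M.blockSize * (c'.offset - c.offset)) := by
  classical
  have hB := M.five_le_blockSize
  rw [step] at hc
  rcases hδ : M.δ c.state (M.scan c) with _ | ⟨q, z, s, mv⟩
  · simp [hδ] at hc
  rcases hy : M.written c z with _ | y
  · simp [hδ, hy] at hc
  rcases hρ : M.stored c s with _ | ρ
  · simp [hδ, hy, hρ] at hc
  simp only [hδ, hy, hρ, Option.some.injEq] at hc
  subst hc
  have happ : Applicable (M.scan c) z s := by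
    unfold Applicable scan
    rcases ht : c.tape 1 with g | a
    · refine ⟨?_, ?_⟩
      · by_contra hs
        simp [stored, ht, hs] at hρ
      · rintro op r rfl
        simp [written, ht] at hy
    · trivial
  have h₀ := execs_copy (d := 1) (s := 3) (by norm_num) A o
  set A₀ := execs (copy 1 3) A o
  have hA₀ : ∀ i, i ≠ 1 + o → A₀ i = A i := fun i hi => by rw [h₀, Function.update_of_ne hi]
  have hs₀ : M.Simulates c.regs c.tape A₀ o := h.congr_scratch fun i hi _ => hA₀ i hi
  obtain ⟨w₁, w₂⟩ := eval_writeInstrs hs₀.cell_one hs₀.regs hy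
  set A₁ := execs (M.writeInstrs z) A₀ o
  obtain ⟨v₁, v₂⟩ := M.eval_storeInstrs s A₁ o
  set A₂ := execs (M.storeInstrs s) A₁ o
  have hs₂ : M.Simulates ρ (Function.update c.tape 1 y) A₂ o := by
    refine hs₀.update (w₁.congr fun f _ _ hf => v₂ f fun r _ => hf r) (fun r => ?_) fun f hf => ?_
    · have hr₁ : A₁ (M.regCoord r + o) = c.regs r := by
        rw [w₂ _ (.inr (.inr ⟨r, rfl⟩)), hs₀.regs]
      have hr₂ : r ∉ s → A₂ (M.regCoord r + o) = c.regs r := fun hr => by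
        rw [v₂ _ fun r' hr' he => ?_, hr₁]
        obtain rfl := M.regCoord_injective he
        exact hr hr'
      rcases ht : c.tape 1 with g | a
      · have hs : s = ∅ := by
          by_contra hs
          simp [stored, ht, hs] at hρ
        obtain rfl : c.regs = ρ := by simpa [stored, ht, hs] using hρ
        exact hr₂ (by simp [hs])
      · obtain rfl : (fun r => if r ∈ s then a else c.regs r) = ρ := by
          rw [stored, ht] at hρ
          simpa using hρ
        by_cases hr : r ∈ s
        · rw [v₁ r hr, w₂ 1 (.inl le_rfl), h₀, Function.update_self]
          have := h.cell_one
          rw [ht] at this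
          simp [hr, this.2]
        · simp [hr, hr₂ hr]
    · rw [v₂ _ fun r _ => ?_, w₂ _ (by omega)]
      have := M.regCoord_bounds r
      omega
  obtain ⟨A₃, e, h₃⟩ := hs₂.eval_moveCode (some (.state q)) mv
  refine ⟨A₃, ?_, by simpa using h₃⟩
  simp only [actCode, hδ, happ, if_true, Code.eval_ops, execs_append, add_sub_cancel_left]
  exact e

/-- `Applicable` expresses that `written` and `stored` both succeed, so the code turns to unloading
whenever `step` is undefined. -/
theorem eval_actCode_of_step_eq_none {c : M.Config} {A : ℤ → K} {o : ℤ} (hc : M.step c = none) :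
    (M.actCode c.state (M.scan c)).eval ord A o = (some .unload, A, o) := by
  classical
  rw [actCode]
  rcases hδ : M.δ c.state (M.scan c) with _ | ⟨q, z, s, mv⟩
  · rfl
  have happ : ¬ Applicable (M.scan c) z s := by
    intro happ
    rw [step, hδ] at hc
    unfold Applicable scan at happ
    rcases ht : c.tape 1 with g | a
    · simp only [ht] at happ
      obtain ⟨rfl, hz⟩ := happ
      rcases z with g' | k | _ | ⟨op, r⟩
      · simp [written, stored, ht] at hc
      · simp [written, stored, ht] at hc
      · simp [written, stored, ht] at hc
      · exact hz op r rfl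
    · rcases z with g' | k | _ | ⟨op, r⟩ <;> simp [written, stored, ht] at hc
  simp [happ]

open Classical in
theorem eval_compareCode (op : CmpOp) (r : R) (T F : Code K (Label Q)) (A : ℤ → K) (o : ℤ) :
    ∃ A', (∀ j, j ≠ 1 + o → j ≠ 2 + o → A' j = A j) ∧
      (M.compareCode op r T F).eval ord A o =
        if op.Holds ord (A (3 + o)) (A (M.regCoord r + o)) then T.eval ord A' o
        else F.eval ord A' o := by
  have hr := M.regCoord_bounds r
  have h₁ : ∀ j, execs (copy 1 3 ++ copy 2 (M.regCoord r)) A o j = if j = 2 + o then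
      A (M.regCoord r + o) else if j = 1 + o then A (3 + o) else A j := by
    intro j
    rw [execs_append, execs_copy (by omega), execs_copy (by omega)]
    simp only [Function.update_apply]
    grind
  set A₁ := execs (copy 1 3 ++ copy 2 (M.regCoord r)) A o with hA₁
  have h₂ : ∀ j, execs (copy 1 (M.regCoord r) ++ copy 2 3) A₁ o j = if j = 2 + o then
      A (3 + o) else if j = 1 + o then A (M.regCoord r + o) else A j := by
    intro j
    rw [execs_append, execs_copy (by omega), execs_copy (by omega)]
    simp only [Function.update_apply, h₁]
    grind
  have hc₁ : A₁ (1 + o) = A (3 + o) := by rw [h₁]; grind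
  have hc₂ : A₁ (2 + o) = A (M.regCoord r + o) := by rw [h₁]; grind
  rcases op with _ | _
  · obtain ⟨A', hA', h⟩ := eval_eqTest ord (swap := copy 1 (M.regCoord r) ++ copy 2 3) T F
      (A := A₁) (o := o) (by rw [h₂, hc₂]; grind) (by rw [h₂, hc₁]; grind)
    refine ⟨A', fun j g₁ g₂ => ?_, ?_⟩
    · rcases hA' with rfl | rfl
      · rw [h₁, if_neg g₂, if_neg g₁]
      · rw [h₂, if_neg g₂, if_neg g₁]
    · rw [compareCode, Code.eval_ops, h, hc₁, hc₂]
      rfl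
  · refine ⟨A₁, fun j g₁ g₂ => by rw [h₁, if_neg g₂, if_neg g₁], ?_⟩
    rw [compareCode, Code.eval_ops, ← hA₁]
    rcases ord with _ | ord
    · simp [CmpOp.Holds]
    · simp only [reduceCtorEq, if_false, Code.eval, branchTest, CmpOp.Holds, hc₁, hc₂]
      simp

variable [Nontrivial K]

-- At most one symbol coordinate is one. If all of them are zero, every test fails and the default
-- of the fold treats the symbol as the blank.
open Classical in
theorem eval_symbolTests (q : Q) {g : Γ} (l : List Γ) (hg : g ∈ l ∨ g = M.b) {A : ℤ → K} {o : ℤ}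
    (hA : ∀ g', A (M.symCoord g' + o) = if g' = g ∧ g ≠ M.b then 1 else 0) :
    ∃ A', (∀ j, j ≠ 1 + o → j ≠ 2 + o → A' j = A j) ∧
      (M.symbolTests q l).eval ord A o = (M.actCode q (.inl g)).eval ord A' o := by
  induction l generalizing A with
  | nil =>
      obtain rfl : g = M.b := by simpa using hg
      exact ⟨A, fun _ _ _ => rfl, rfl⟩
  | cons g' l ih =>
      have hb := M.symCoord_bounds g'
      obtain ⟨A₁, h₁, h₂, h₃⟩ := eval_flagTest ord (i := M.symCoord g')
        (M.actCode q (.inl g')) (M.symbolTests q l) A o (by omega)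
      rw [hA] at h₂ h₃
      by_cases hg' : g' = g ∧ g ≠ M.b
      · refine ⟨A₁, h₁, (h₂ (if_pos hg')).trans ?_⟩
        rw [hg'.1]
      · obtain ⟨A₂, g₁, g₂⟩ := ih (A := A₁) (by grind) (fun g'' => by
          have hb := M.symCoord_bounds g''
          rw [h₁ _ (by omega) (by omega), hA])
        exact ⟨A₂, fun j r₁ r₂ => by rw [g₁ j r₁ r₂, h₁ j r₁ r₂],
          (h₃ (if_neg hg') zero_ne_one).trans g₂⟩

theorem Simulates.eval_state {c : M.Config} {A : ℤ → K} {o : ℤ}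
    (h : M.Simulates c.regs c.tape A o) :
    ∃ A', M.Simulates c.regs c.tape A' o ∧ (M.prog (.state c.state)).eval ord A o =
      (M.actCode c.state (M.scan c)).eval ord A' o := by
  classical
  have hB := M.five_le_blockSize
  obtain ⟨A₁, h₁, h₂, h₃⟩ := eval_flagTest ord (i := M.blockSize)
    (M.compareCode (M.P c.state).1 (M.P c.state).2 (M.actCode c.state (.inr true))
      (M.actCode c.state (.inr false))) (M.symbolTests c.state M.symList) A o (by omega)
  have hs₁ := h.congr_scratch h₁
  have hx := h.cell_one
  have hx₁ := hs₁.cell_one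
  rcases ht : c.tape 1 with g | a
  · rw [ht] at hx hx₁
    obtain ⟨A₂, g₁, g₂⟩ := eval_symbolTests c.state M.symList (.inl (M.mem_symList g))
      (A := A₁) (o := o) (fun g' => by rw [hx₁.2])
    refine ⟨A₂, hs₁.congr_scratch g₁, ?_⟩
    have : M.scan c = .inl g := by simp [scan, ht]
    rw [this, ← g₂]
    exact h₃ hx.1 zero_ne_one
  · rw [ht] at hx hx₁
    obtain ⟨A₂, g₁, g₂⟩ := M.eval_compareCode (M.P c.state).1 (M.P c.state).2
      (M.actCode c.state (.inr true)) (M.actCode c.state (.inr false)) A₁ o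
    refine ⟨A₂, hs₁.congr_scratch g₁, (h₂ hx.1).trans (g₂.trans ?_)⟩
    rw [hx₁.2, hs₁.regs]
    have : M.scan c = .inr (decide (((M.P c.state).1 : CmpOp).Holds ord a
        (c.regs (M.P c.state).2))) := by
      simp only [scan, ht]
    rw [this]
    split_ifs with hh <;> simp [hh]

theorem Simulates.reaches {w : List (Γ ⊕ K)} {A : ℤ → K} {o : ℤ}
    (h : M.Simulates (M.init w).regs (M.init w).tape A o)
    (hU : ∀ n, o + M.blockSize * (M.run w n).offset ∈ U) (n : ℕ)
    (hn : ∀ j < n, M.step (M.run w j) ≠ none) :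
    ∃ A', M.Reaches U n (some (.state M.q₀), A, o)
        (some (.state (M.run w n).state), A', o + M.blockSize * (M.run w n).offset) ∧
      M.Simulates (M.run w n).regs (M.run w n).tape A' (o + M.blockSize * (M.run w n).offset) := by
  induction n with
  | zero =>
      refine ⟨A, ?_, ?_⟩
      · simpa [run, init] using Reaches.refl _
      · simpa [run, init] using h
  | succ n ih =>
      obtain ⟨A₁, s₁, h₁⟩ := ih fun j hj => hn j (by omega)
      obtain ⟨A₂, h₂, e₂⟩ := h₁.eval_state
      obtain ⟨c', hc'⟩ := Option.ne_none_iff_exists'.1 (hn n n.lt_succ_self)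
      obtain ⟨A₃, e₃, h₃⟩ := h₂.eval_actCode hc'
      have hrun : M.run w (n + 1) = c' := by
        rw [run, Function.iterate_succ_apply', ← run, hc']
        rfl
      rw [show o + M.blockSize * (M.run w n).offset + M.blockSize * (c'.offset - (M.run w n).offset)
        = o + M.blockSize * c'.offset by ring] at e₃ h₃
      rw [hrun]
      exact ⟨A₃, s₁.trans (.single (hU n) (e₂.trans e₃)), h₃⟩

theorem Simulates.reaches_unload {w : List (Γ ⊕ K)} {A : ℤ → K} {o : ℤ}
    (h : M.Simulates (M.init w).regs (M.init w).tape A o)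
    (hU : ∀ n, o + M.blockSize * (M.run w n).offset ∈ U) (n : ℕ)
    (hn : ∀ j < n, M.step (M.run w j) ≠ none) (hn' : M.step (M.run w n) = none) :
    ∃ A', M.Reaches U (n + 1) (some (.state M.q₀), A, o)
        (some .unload, A', o + M.blockSize * (M.run w n).offset) ∧
      M.Simulates (M.run w n).regs (M.run w n).tape A' (o + M.blockSize * (M.run w n).offset) := by
  obtain ⟨A₁, s₁, h₁⟩ := h.reaches hU n hn
  obtain ⟨A₂, h₂, e₂⟩ := h₁.eval_state
  exact ⟨A₂, s₁.trans (.single (hU n) (e₂.trans (eval_actCode_of_step_eq_none hn'))), h₂⟩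

end KTM

namespace KTM

variable {K : Type*} [Semiring K] {ord : Option (SemiringOrder K)}
  {Q R Γ : Type*} [Finite Q] [Finite R] [Finite Γ] {M : KTM ord Q R Γ} {U : Set ℤ}

/-! ### The whole simulation -/

/-- The input mapping has the form of the invariant from the start: coordinate `0` is the separator
and there are no blocks. -/
theorem unpacking_bssInput (x : List K) : Unpacking M.blockSize (bssInput x) 0 0 [] x := by
  have h : ∀ i, bssInput x i = if 1 ≤ i then x.getD (i.toNat - 1) 0
      else if -(x.length : ℤ) ≤ i ∧ i ≤ -1 then 1 else 0 := fun _ => rfl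
  refine ⟨fun i hi => ?_, fun i hi hi' => ?_, ?_, .inl ⟨rfl, rfl⟩, fun j hj => ?_, fun i hi => ?_⟩
  · rw [h, if_neg (by omega), if_neg (by omega)]
  · rw [h, if_neg (by omega), if_pos (by omega)]
  · rw [h, if_neg (by omega), if_neg (by omega)]
  · rw [h, if_pos (by omega), show (0 + 1 + (j : ℤ)).toNat - 1 = j by omega,
      List.getD_eq_getElem _ _ hj]
  · rw [h, if_pos (by omega), List.getD_eq_default _ _ (by omega)]

theorem Unpacking.getElem {A : ℤ → K} {p q : ℤ} {vs xs : List K} {B : ℕ}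
    (h : Unpacking B A p q vs xs) (j : ℕ) (hj : j < vs.length) :
    A (p + B * j + 3) = vs[j] ∧ A (p + B * j + B) = 1 := by
  rcases h.blocks with ⟨rfl, rfl⟩ | ⟨ws, w, rfl, hws, hw⟩
  · simp at hj
  · rcases lt_or_ge j ws.length with hj' | hj'
    · have := hws.getElem j hj'
      rw [List.getElem_append_left hj']
      exact ⟨this.val, this.flag⟩
    · obtain rfl : j = ws.length := by
        simp at hj
        omega
      have hp : p + B * ws.length = q - B := by rw [hws.le]; ring
      rw [List.getElem_concat_length rfl, hp]
      exact ⟨hw.val, hw.flag⟩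

/-- Inside the blocks the flag is one, so remnants in symbol coordinates are irrelevant; outside,
all is zero and hence blank. Only the registers in the block under the head need to be cleared. -/
theorem Unpacking.simulates {A : ℤ → K} {p q : ℤ} {x : List K}
    (h : Unpacking M.blockSize A p q x []) :
    M.Simulates (M.init (x.map .inr)).regs (M.init (x.map .inr)).tape
      (execs (consts (M.regList.map fun r => (M.regCoord r, 0))) A p) p := by
  have hB := M.five_le_blockSize
  have hq := h.le
  set l : List (ℤ × K) := M.regList.map fun r => (M.regCoord r, 0) with hl
  have hfirst : l.map Prod.fst = M.regList.map M.regCoord := by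
    rw [hl, List.map_map]
    rfl
  have h₁ : ∀ r, execs (consts l) A p (M.regCoord r + p) = 0 := fun r =>
    execs_consts (a := (M.regCoord r, (0 : K)))
      (by rw [hfirst]; exact M.nodup_regList.map M.regCoord_injective) A p
      (List.mem_map_of_mem (f := fun r => (M.regCoord r, (0 : K))) (M.mem_regList r))
  have h₂ : ∀ i, (∀ r, M.regCoord r + p ≠ i) → execs (consts l) A p i = A i := fun i hi =>
    execs_consts_of_notMem A fun a ha => by
      obtain ⟨r, -, rfl⟩ := List.mem_map.1 ha
      exact hi r
  refine ⟨fun i => ?_, h₁⟩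
  have h₃ : ∀ f : ℤ, 3 ≤ f → f ≤ M.blockSize → (∀ r, f ≠ M.regCoord r) →
      execs (consts l) A p (f + (p + M.blockSize * (i - 1))) =
        A (f + (p + M.blockSize * (i - 1))) := by
    intro f hf₁ hf₂ hf
    refine h₂ _ fun r hr => hf r ?_
    have := M.regCoord_bounds r
    exact (eq_of_block_eq (B := M.blockSize) (i := i - 1) (j := 0) (by omega) (by omega)
      (by linarith)).2
  refine Encodes.congr (A := A) ?_ h₃
  have hnn : ∀ k : ℤ, 0 ≤ k → 0 ≤ M.blockSize * k := fun k hk => by positivity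
  have hblank : (∀ f : ℤ, 3 ≤ f → f ≤ M.blockSize → A (f + (p + M.blockSize * (i - 1))) = 0) →
      M.Encodes A (p + M.blockSize * (i - 1)) (.inl M.b) := by
    intro hz
    refine ⟨hz _ (by omega) le_rfl, fun g' => ?_⟩
    have hs := M.symCoord_bounds g'
    have hG : 5 + Nat.card Γ ≤ M.blockSize := by unfold blockSize; omega
    rw [hz _ (by omega) (by omega)]
    simp
  simp only [init, inputTape]
  split_ifs with hi
  · rcases lt_or_ge (i.toNat - 1) x.length with hj | hj
    · obtain ⟨e₁, e₂⟩ := h.getElem _ hj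
      rw [List.getD_eq_getElem _ _ (by simpa using hj), List.getElem_map,
        show i - 1 = ((i.toNat - 1 : ℕ) : ℤ) by omega]
      exact ⟨by rw [add_comm, e₂], by rw [add_comm, e₁]⟩
    · rw [List.getD_eq_default _ _ (by simpa using hj)]
      refine hblank fun f hf₁ hf₂ => h.zero_of_gt _ ?_
      have := mul_le_mul_of_nonneg_left (show (x.length : ℤ) ≤ i - 1 by omega)
        (Int.natCast_nonneg M.blockSize)
      simp only [List.length_nil, Nat.cast_zero, add_zero]
      linarith
  · refine hblank fun f hf₁ hf₂ => ?_
    have := mul_le_mul_of_nonneg_left (show i - 1 ≤ -1 by omega)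
      (Int.natCast_nonneg M.blockSize)
    -- The separator `p` is also the last cell of the block before the first one, and serves as its
    -- zero flag.
    rcases eq_or_ne (f + (p + M.blockSize * (i - 1))) p with he | he
    · rw [he, h.sep]
    · exact h.zero_of_lt _ (by
        simp only [List.length_nil, Nat.cast_zero, sub_zero]
        omega)

/-- The first blank on the tape comes after the output. -/
theorem output_eq {tape : ℤ → Γ ⊕ K} {y : List K}
    (hfin : {i | tape i ≠ .inl M.b}.Finite) (h : M.output tape = y.map .inr) :
    (∀ (j : ℕ) (hj : j < y.length), tape (j + 1) = .inr y[j]) ∧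
      tape (y.length + 1) = .inl M.b := by
  -- Finiteness provides a blank. Without one, the infimum would take the default value `0` for the
  -- empty set and would not point to a blank.
  have hne : {l : ℕ | tape ((l : ℤ) + 1) = .inl M.b}.Nonempty := by
    by_contra hne
    rw [Set.not_nonempty_iff_eq_empty, Set.eq_empty_iff_forall_notMem] at hne
    refine Set.infinite_range_of_injective (f := fun l : ℕ => (l : ℤ) + 1)
      (fun a b hab => by simpa using hab) (hfin.subset ?_)
    rintro _ ⟨l, rfl⟩
    exact hne l
  have hlen : y.length = sInf {l : ℕ | tape ((l : ℤ) + 1) = .inl M.b} := by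
    have := congrArg List.length h
    simpa [output] using this.symm
  refine ⟨fun j hj => ?_, ?_⟩
  · have h' : (M.output tape)[j]? = some (.inr y[j]) := by
      rw [h, List.getElem?_map, List.getElem?_eq_getElem hj]
      rfl
    rw [output, List.getElem?_ofFn, dif_pos (hlen ▸ hj)] at h'
    exact Option.some.inj h'
  · rw [hlen]
    exact Nat.sInf_mem hne

theorem Simulates.blks {ρ : R → K} {tape : ℤ → Γ ⊕ K} {A : ℤ → K} {o : ℤ} {y : List K}
    (h : M.Simulates ρ tape A o) (hy : ∀ (j : ℕ) (hj : j < y.length), tape (j + 1) = .inr y[j])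
    (hb : tape (y.length + 1) = .inl M.b) :
    Blks M.blockSize (fun _ => True) A o y (o + y.length * M.blockSize) ∧
      A (o + y.length * M.blockSize + M.blockSize) = 0 := by
  refine ⟨.of_getElem rfl fun j hj => ?_, ?_⟩
  · have := h.cells (j + 1)
    rw [hy j hj, add_sub_cancel_right] at this
    exact ⟨by rw [add_comm, this.2], trivial, by rw [add_comm, this.1]⟩
  · have := h.cells (y.length + 1)
    rw [hb, add_sub_cancel_right] at this
    rw [add_comm, mul_comm, this.1]

variable [Nontrivial K]

/-- The simulation of a halting computation, from the input mapping to the output mapping. -/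
theorem reaches_packed {x y : List K} {n : ℕ}
    (hn : ∀ j < n, M.step (M.run (x.map .inr) j) ≠ none)
    (hn' : M.step (M.run (x.map .inr) n) = none)
    (hfin : {i | (M.run (x.map .inr) n).tape i ≠ .inl M.b}.Finite)
    (hy : M.output (M.run (x.map .inr) n).tape = y.map .inr) {p : ℤ}
    (hp : p = x.length - M.blockSize * x.length)
    (hU₁ : Set.Icc (-((M.blockSize + 1) * x.length + 2) : ℤ) x.length ⊆ U)
    (hU₂ : ∀ j, p + M.blockSize * (M.run (x.map .inr) j).offset ∈ U)
    (hU₃ : Set.Icc (p + M.blockSize * (M.run (x.map .inr) n).offset - 2)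
      (p + M.blockSize * (M.run (x.map .inr) n).offset + y.length * M.blockSize) ⊆ U) :
    ∃ A o, M.Reaches U (x.length * (2 * x.length + M.blockSize + 7) + (n + 2) +
        (y.length + 1) * (2 * y.length + M.blockSize + 10))
      (some (.fetch true), bssInput x, 0) (none, A, o) ∧ Packed A o y := by
  have hB := M.five_le_blockSize
  obtain ⟨A₁, s₁, h₁⟩ := reaches_unpack (M := M) (U := U) (unpacking_bssInput x)
    ((Set.Icc_subset_Icc (by linarith) (by omega)).trans hU₁)
  rw [zero_add, ← hp, List.nil_append] at s₁ h₁
  have hmul := mul_le_mul_of_nonneg_right (show (1 : ℤ) ≤ M.blockSize by omega)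
    (Int.natCast_nonneg x.length)
  have hpn : p ≤ 0 := by rw [hp]; linarith
  have hp' : p ∈ Set.Icc (-((M.blockSize + 1) * x.length + 2) : ℤ) x.length := by
    constructor
    · rw [hp]; nlinarith
    · omega
  have s₂ : M.Reaches U 1 (some (.fetch x.isEmpty), A₁, p) (some (.state M.q₀),
      execs (consts (M.regList.map fun r => (M.regCoord r, 0))) A₁ p, p) := by
    refine .single (hU₁ hp') ?_
    rw [prog, Code.eval_shifts]
    have hd : p + ((2 : ℕ) : ℤ) * Dir.right.delta = p - 2 := by simp [Dir.delta, sub_eq_add_neg]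
    rw [hd, (eval_isOne ord _ _ (.inl ⟨rfl, rfl⟩) ?_).2 (h₁.zero_of_lt _ (by simp; omega))
      zero_ne_one]
    · have hd' : p - 2 + ((2 : ℕ) : ℤ) * Dir.left.delta = p := by simp [Dir.delta]
      rw [Code.eval_shifts, hd', Code.eval_ops, Code.eval_jump]
    · rw [← h₁.sep]
      congr 1
      ring
  obtain ⟨A₃, s₃, h₃⟩ := h₁.simulates.reaches_unload hU₂ n hn hn'
  obtain ⟨t₁, t₂⟩ := output_eq hfin hy
  obtain ⟨b₁, b₂⟩ := h₃.blks t₁ t₂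
  obtain ⟨A₄, o, s₄, h₄⟩ := KTM.reaches_unload b₁ b₂ hU₃
  refine ⟨A₄, o, (((s₁.trans s₂).trans s₃).trans s₄).mono ?_, h₄⟩
  simp only [List.length_nil, add_zero]
  omega

end KTM

/-! ### Counting cells and the final bounds -/

theorem encard_Icc_int (a b : ℤ) : (Set.Icc a b).encard = ((b + 1 - a).toNat : ℕ) := by
  rw [← Finset.coe_Icc, Set.encard_coe_eq_coe_finsetCard, Int.card_Icc]

theorem encard_Icc_le {a b : ℤ} {k : ℕ} (h : b + 1 - a ≤ k) : (Set.Icc a b).encard ≤ k := by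
  rw [encard_Icc_int]
  exact_mod_cast (show (b + 1 - a).toNat ≤ k by omega)

theorem encard_biUnion_Icc_le {T : Set ℤ} {k : ℕ} (hT : T.encard ≤ k) (g : ℤ → ℤ) (W : ℕ) :
    (⋃ a ∈ T, Set.Icc (g a - W) (g a + W)).encard ≤ (k * (2 * W + 1) : ℕ) := by
  have hfin : T.Finite := Set.finite_of_encard_le_coe hT
  obtain ⟨T, rfl⟩ := hfin.exists_finset_coe
  rw [Set.encard_coe_eq_coe_finsetCard] at hT
  have hcard : T.card ≤ k := by exact_mod_cast hT
  have : (⋃ a ∈ (T : Set ℤ), Set.Icc (g a - W) (g a + W)) =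
      (T.biUnion fun a => Finset.Icc (g a - W) (g a + W) : Finset ℤ) := by
    ext
    simp
  rw [this, Set.encard_coe_eq_coe_finsetCard]
  have h := Finset.card_biUnion_le_card_mul T (fun a => Finset.Icc (g a - W) (g a + W))
    (2 * W + 1) fun a _ => by
      rw [Int.card_Icc]
      omega
  exact_mod_cast h.trans (Nat.mul_le_mul_right _ hcard)

theorem BSSMachine.HaltsWithin.mono {K : Type*} [Semiring K] {M : BSSMachine K}
    {ord : Option (SemiringOrder K)} {x : List K} {S T : ℕ} (h : M.HaltsWithin ord x S)
    (hST : S ≤ T) : M.HaltsWithin ord x T := by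
  obtain ⟨j, rfl⟩ := Nat.exists_eq_add_of_le' hST
  unfold HaltsWithin at h ⊢
  rw [run, Function.iterate_add_apply, ← run, iterate_step_of_output h]
  exact h

namespace KTM

variable {K : Type*} [Semiring K] {ord : Option (SemiringOrder K)}
  {Q R Γ : Type*} [Finite Q] [Finite R] [Finite Γ] {M : KTM ord Q R Γ}

theorem run_eq_of_le {w : List (Γ ⊕ K)} {m n : ℕ} (h : M.HaltsWithin w m) (hmn : m ≤ n) :
    M.run w n = M.run w m := by
  obtain ⟨j, rfl⟩ := Nat.exists_eq_add_of_le' hmn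
  rw [run, Function.iterate_add_apply, ← run]
  refine Function.iterate_fixed ?_ j
  unfold HaltsWithin at h
  rw [h, Option.getD_none]

theorem finite_nonblank {w : List (Γ ⊕ K)} (h : (M.usedCells w).Finite) (n : ℕ) :
    {i | (M.run w n).tape i ≠ .inl M.b}.Finite := by
  refine Set.Finite.of_injOn (f := fun i => i + (M.run w n).offset) (t := M.usedCells w)
    (fun i hi => ⟨n, i, rfl, .inl hi⟩) (fun i _ j _ hij => by simpa using hij) h

/-- Applied at time `0` and at the halting time, this bounds the lengths of input and output by the
space. -/
theorem length_le_of_nonblank {w : List (Γ ⊕ K)} {s : ℕ} (h : (M.usedCells w).encard ≤ s) (n l : ℕ)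
    (hl : ∀ j < l, (M.run w n).tape (j + 1) ≠ .inl M.b) : l ≤ s := by
  have h₁ : Set.Icc (1 + (M.run w n).offset) (l + (M.run w n).offset) ⊆ M.usedCells w := by
    rintro i ⟨hi₁, hi₂⟩
    refine ⟨n, i - (M.run w n).offset, by ring, .inl ?_⟩
    have := hl (i - (M.run w n).offset - 1).toNat (by omega)
    rwa [show (((i - (M.run w n).offset - 1).toNat : ℕ) : ℤ) + 1 = i - (M.run w n).offset by
      omega] at this
  have h₂ := (Set.encard_le_encard h₁).trans h
  rw [encard_Icc_int] at h₂
  have : (l + (M.run w n).offset + 1 - (1 + (M.run w n).offset)).toNat ≤ s := by exact_mod_cast h₂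
  omega

theorem exists_bss_bounds [Nontrivial K] (M : KTM ord Q R Γ) :
    ∃ (M' : BSSMachine K) (c : ℕ), ∀ (x y : List K) (t s : ℕ),
      M.HaltsWithin (x.map .inr) t → M.output (M.run (x.map .inr) t).tape = y.map .inr →
      (M.usedCells (x.map .inr)).encard ≤ s →
      ∃ n, M'.HaltsWithin ord x n ∧ bssOutput (M'.run ord x n).state = y ∧
        n ≤ c * (t + x.length ^ 2 + y.length ^ 2 + 1) ∧
        (M'.usedCells ord x).encard ≤ (c * s + c : ℕ) := by
  classical
  obtain ⟨D, W, h⟩ := exists_compile_bounds M.prog (.fetch true) ord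
  set B := M.blockSize with hB
  -- The first summand is for the time: `D` nodes per piece, and `B + 14` for the number of pieces.
  -- The second one is for the space.
  refine ⟨compile M.prog (.fetch true), D * (B + 14) + (2 * B + 6 * W + 20),
    fun x y t s ht hy hs => ?_⟩
  have hex : ∃ n, M.HaltsWithin (x.map .inr) n := ⟨t, ht⟩
  -- The least halting time, because the simulation requires all earlier steps to be defined.
  set τ := Nat.find hex with hτ
  have hτt : τ ≤ t := Nat.find_min' hex ht
  rw [run_eq_of_le (Nat.find_spec hex) hτt] at hy
  have hfin := finite_nonblank (M := M) (Set.finite_of_encard_le_coe hs) τ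
  have hn : x.length ≤ s := length_le_of_nonblank hs 0 _ fun j hj => by
    simp [run, init, inputTape, hj, show (1 : ℤ) ≤ j + 1 by omega]
  have hm : y.length ≤ s := length_le_of_nonblank hs τ _ fun j hj => by
    rw [(output_eq hfin hy).1 j hj]
    simp
  set p : ℤ := x.length - B * x.length with hp
  set a : ℤ := p + B * (M.run (x.map .inr) τ).offset with ha
  set U₁ : Set ℤ := Set.Icc (-((B + 1) * x.length + 2) : ℤ) x.length with hU₁
  -- The offsets of the simulation are indexed by time, but will be counted by head positions, each
  -- of which is a used cell of `M`.
  set U₂ : Set ℤ := Set.range fun j => p + B * (M.run (x.map .inr) j).offset with hU₂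
  set U₃ : Set ℤ := Set.Icc (a - 2) (a + y.length * B) with hU₃
  obtain ⟨A, o, ⟨N, hN, hruns⟩, hpk⟩ := reaches_packed (M := M) (U := U₁ ∪ U₂ ∪ U₃) (n := τ)
    (fun j hj => Nat.find_min hex hj) (Nat.find_spec hex) hfin hy hp
    (Set.subset_union_left.trans Set.subset_union_left)
    (fun j => .inl (.inr ⟨j, rfl⟩)) Set.subset_union_right
  obtain ⟨h₁, h₂, h₃⟩ := h x _ N A o y hruns
    (fun i hi => hpk.ones _ (by omega) (by omega))
    (by rw [show -((y.length : ℤ) + 1) + o = o - y.length - 1 by ring, hpk.zero]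
        exact zero_ne_one)
    (fun i hi => by rw [← hpk.rest i hi]; congr 1; ring)
  refine ⟨_, h₁, h₂, ?_, ?_⟩
  · have e₁ : x.length ≤ x.length ^ 2 := Nat.le_self_pow two_ne_zero _
    have e₂ : y.length ≤ y.length ^ 2 := Nat.le_self_pow two_ne_zero _
    have e₃ : N + 1 ≤ (B + 14) * (t + x.length ^ 2 + y.length ^ 2 + 1) := by
      nlinarith [Nat.mul_le_mul_left B e₁, Nat.mul_le_mul_left B e₂, Nat.zero_le (B * t)]
    calc D * (N + 1) ≤ D * ((B + 14) * (t + x.length ^ 2 + y.length ^ 2 + 1)) :=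
          Nat.mul_le_mul_left _ e₃
      _ = D * (B + 14) * (t + x.length ^ 2 + y.length ^ 2 + 1) := by ring
      _ ≤ _ := Nat.mul_le_mul_right _ (Nat.le_add_right _ _)
  · have hsub : (compile M.prog (.fetch true)).usedCells ord x ⊆
        Set.Icc (-(x.length : ℤ)) x.length ∪
        Set.Icc (-((B + 1) * x.length + 2) - W : ℤ) (x.length + W) ∪
        (⋃ i ∈ M.usedCells (x.map .inr), Set.Icc (p + B * (i - 1) - W) (p + B * (i - 1) + W)) ∪
        Set.Icc (a - 2 - W) (a + y.length * B + W) ∪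
        Set.Icc (o - (y.length + 1)) (o + y.length) := by
      intro i hi
      rcases h₃ hi with (hi | hi) | hi
      · exact .inl (.inl (.inl (.inl hi)))
      · obtain ⟨u, hu, hi⟩ := Set.mem_iUnion₂.1 hi
        rw [Set.mem_Icc] at hi
        rcases hu with (hu | ⟨j, rfl⟩) | hu
        · rw [hU₁, Set.mem_Icc] at hu
          exact .inl (.inl (.inl (.inr ⟨by linarith, by linarith⟩)))
        · refine .inl (.inl (.inr (Set.mem_iUnion₂.2
            ⟨1 + (M.run (x.map .inr) j).offset, ⟨j, 1, rfl, .inr rfl⟩, ?_⟩)))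
          rw [add_sub_cancel_left]
          exact hi
        · rw [hU₃, Set.mem_Icc] at hu
          exact .inl (.inr ⟨by linarith, by linarith⟩)
      · exact .inr hi
    have e₁ := encard_Icc_le (a := -(x.length : ℤ)) (b := x.length) (k := 2 * x.length + 1)
      (by push_cast; linarith)
    have e₂ := encard_Icc_le (a := (-((B + 1) * x.length + 2) - W : ℤ)) (b := x.length + W)
      (k := (B + 2) * x.length + 2 * W + 3) (by push_cast; linarith)
    have e₃ := encard_biUnion_Icc_le hs (fun i => p + B * (i - 1)) W
    have e₄ := encard_Icc_le (a := a - 2 - W) (b := a + y.length * B + W)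
      (k := B * y.length + 2 * W + 3) (by push_cast; linarith)
    have e₅ := encard_Icc_le (a := o - (y.length + 1)) (b := o + y.length)
      (k := 2 * y.length + 2) (by push_cast; linarith)
    refine (Set.encard_le_encard hsub).trans (((Set.encard_union_le _ _).trans (add_le_add
      ((Set.encard_union_le _ _).trans (add_le_add ((Set.encard_union_le _ _).trans (add_le_add
      ((Set.encard_union_le _ _).trans (add_le_add e₁ e₂)) e₃)) e₄)) e₅)).trans ?_)
    norm_cast
    have f₁ := Nat.mul_le_mul_left B hn
    have f₂ := Nat.mul_le_mul_left B hm
    nlinarith [Nat.zero_le (D * (B + 14) * s), Nat.zero_le (D * (B + 14)), Nat.zero_le (W * s)]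

end KTM

end KMachine

end

/-! ### The main theorem -/

theorem mainTheorem6 {K : Type*} [Semiring K] [Nontrivial K]
    (ord : Option (KMachine.SemiringOrder K))
    {Q R Γ : Type*} [Finite Q] [Finite R] [Finite Γ]
    (M : KMachine.KTM ord Q R Γ) (f : List K → List K) (t s : ℕ → ℕ)
    (hf : M.Computes f) (ht : M.RunsInTime t) (hs : M.RunsInSpace s) :
    ∃ (M' : KMachine.BSSMachine K) (c : ℕ), M'.Computes ord f ∧
      ∀ x : List K,
        M'.HaltsWithin ord x (c * (t x.length + x.length ^ 2 + (f x).length ^ 2 + 1)) ∧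
        M'.UsesSpaceAtMost ord x (c * s x.length + c) := by
  have hin : ∀ x : List K, ∀ a ∈ x.map (Sum.inr (α := Γ)), a ∈ M.inputSymbols := by
    intro x a ha
    obtain ⟨v, -, rfl⟩ := List.mem_map.1 ha
    rw [hf.1]
    exact ⟨v, rfl⟩
  obtain ⟨M', c, h⟩ := M.exists_bss_bounds
  have key : ∀ x : List K, ∃ n, M'.HaltsWithin ord x n ∧
      KMachine.bssOutput (M'.run ord x n).state = f x ∧
      n ≤ c * (t x.length + x.length ^ 2 + (f x).length ^ 2 + 1) ∧
      (M'.usedCells ord x).encard ≤ (c * s x.length + c : ℕ) := by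
    intro x
    have hlen : (x.map (Sum.inr (α := Γ))).length = x.length := List.length_map ..
    have ht' := ht _ (hin x)
    have hs' := (hs _ (hin x)).2
    rw [hlen] at ht' hs'
    obtain ⟨n, hn, hout⟩ := hf.2 x
    refine h x (f x) _ _ ht' ?_ hs'
    -- The run is constant after halting, so the output at the time given by `hf` is also the output
    -- at time `t x.length`.
    rcases le_total n (t x.length) with hle | hle
    · rw [KMachine.KTM.run_eq_of_le hn hle, hout]
    · rw [← KMachine.KTM.run_eq_of_le ht' hle, hout]
  refine ⟨M', c, fun x => ?_, fun x => ?_⟩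
  · obtain ⟨n, h₁, h₂, -⟩ := key x
    exact ⟨n, h₁, h₂⟩
  · obtain ⟨n, h₁, -, h₂, h₃⟩ := key x
    exact ⟨h₁.mono h₂, ⟨n, h₁⟩, h₃⟩
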